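/- Let $\Bbbk$ be an algebraically closed field and let $n>1$ be an integer. Let $\Lambda_n$ be the quotient of the path algebra over $\Bbbk$ of the quiver with vertices $1,\dots,n$ and arrows $\alpha_i\colon i\to i+1$, $\alpha_i'\colon i+1\to i$ ($1\le i\le n-1$) by the ideal generated by the relations $$\alpha_{i+1}\alpha_i=0,\qquad \alpha_i'\alpha_{i+1}'=0\quad(1\le i\le n-2),\qquad \alpha_i\alpha_i'=0\quad(1\le i\le n-1),$$ where paths are composed from right to left (so that $\alpha_i'\alpha_i$ denotes the path $i\to i+1\to i$). For $1\le i\le n$ let $L(i)$ be the simple left $\Lambda_n$-module at the vertex $i$. Put $\Delta(1)=\nabla(1)=L(1)$. For $2\le i\le n$ let the standard module $\Delta(i)$ be the two-dimensional module with basis vectors $x$ at the vertex $i$ and $y$ at the vertex $i-1$, with $\alpha_{i-1}'x=y$ and all other arrows acting by zero. Let the costandard module $\nabla(i)$ be the two-dimensional module with basis vectors $x$ at the vertex $i$ and $y$ at the vertex $i-1$, with $\alpha_{i-1}y=x$ and all other arrows acting by zero. A finite-dimensional left $\Lambda_n$-module $M$ has a standard (respectively costandard) filtration if there is a chain of submodules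 $0=M_0\subseteq M_1\subseteq\dots\subseteq M_r=M$ such that each $M_s/M_{s-1}$ ($1\le s\le r$) is isomorphic to some $\Delta(i)$ (respectively to some $\nabla(i)$). The module $M$ is self-orthogonal if $\operatorname{Ext}^m_{\Lambda_n}(M,M)=0$ for all $m>0$. Let $M$ be an indecomposable finite-dimensional left $\Lambda_n$-module that has neither a standard filtration nor a costandard filtration. Then $M$ is not self-orthogonal, i.e. $\operatorname{Ext}^m_{\Lambda_n}(M,M)\neq 0$ for some $m>0$. -/

import Mathlib

universe u

namespace DualExtension

/-- Left endpoint `i` of the `i`-th pair of arrows.  The vertices `1, …, n` of the quiver are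
represented by `Fin n`, the vertex `i + 1` being the element with value `i`. -/
def lo {n : ℕ} (i : ℕ) (h : i + 1 < n) : Fin n := ⟨i, Nat.lt_of_succ_lt h⟩

/-- Right endpoint `i + 1` of the `i`-th pair of arrows. -/
def hi {n : ℕ} (i : ℕ) (h : i + 1 < n) : Fin n := ⟨i + 1, h⟩

/-- Trivial paths and arrows of the double of the linear quiver on `n` vertices:
`up i : i ⟶ i + 1` is the arrow `α` and `down i : i + 1 ⟶ i` is the arrow `α'`. -/
inductive Gen (n : ℕ) : Type
  | vertex (i : Fin n) : Gen n
  | up (i : ℕ) (h : i + 1 < n) : Gen n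
  | down (i : ℕ) (h : i + 1 < n) : Gen n

section

variable (k : Type*) [Field k] (n : ℕ)

/-- The trivial path `e i` in the free algebra. -/
def fe (i : Fin n) : FreeAlgebra k (Gen n) := FreeAlgebra.ι k (Gen.vertex i)

/-- The arrow `α i : i ⟶ i + 1` in the free algebra. -/
def fα (i : ℕ) (h : i + 1 < n) : FreeAlgebra k (Gen n) := FreeAlgebra.ι k (Gen.up i h)

/-- The arrow `α' i : i + 1 ⟶ i` in the free algebra. -/
def fα' (i : ℕ) (h : i + 1 < n) : FreeAlgebra k (Gen n) := FreeAlgebra.ι k (Gen.down i h)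

/-- The defining relations.  Paths are composed from right to left, as is appropriate for left
modules.  The relations down to `down_tgt` present the path algebra of the quiver; the last three
are the relations `α (i+1) α i = 0`, `α' i α' (i+1) = 0` and `α i α' i = 0`. -/
inductive Rel : FreeAlgebra k (Gen n) → FreeAlgebra k (Gen n) → Prop
  | idem (i : Fin n) : Rel (fe k n i * fe k n i) (fe k n i)
  | orth (i j : Fin n) (hij : i ≠ j) : Rel (fe k n i * fe k n j) 0
  | one : Rel (∑ i, fe k n i) 1
  | up_src (i : ℕ) (h : i + 1 < n) : Rel (fα k n i h * fe k n (lo i h)) (fα k n i h)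
  | up_tgt (i : ℕ) (h : i + 1 < n) : Rel (fe k n (hi i h) * fα k n i h) (fα k n i h)
  | down_src (i : ℕ) (h : i + 1 < n) : Rel (fα' k n i h * fe k n (hi i h)) (fα' k n i h)
  | down_tgt (i : ℕ) (h : i + 1 < n) : Rel (fe k n (lo i h) * fα' k n i h) (fα' k n i h)
  | up_up (i : ℕ) (h : i + 1 + 1 < n) :
      Rel (fα k n (i + 1) h * fα k n i (Nat.lt_of_succ_lt h)) 0
  | down_down (i : ℕ) (h : i + 1 + 1 < n) :
      Rel (fα' k n i (Nat.lt_of_succ_lt h) * fα' k n (i + 1) h) 0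
  | up_down (i : ℕ) (h : i + 1 < n) : Rel (fα k n i h * fα' k n i h) 0

/-- The algebra `Λ_n`: the path algebra of the double of the linear quiver on `n` vertices modulo
the relations above, i.e. the dual extension algebra of `A_n = k𝔸_n / (rad k𝔸_n)²` and its
opposite. -/
abbrev Lam : Type _ := RingQuot (Rel k n)

end

section

variable (k : Type*) [Field k] {n : ℕ}

/-- Positions of the composition factors of the (co)standard module at the vertex `i`:
the vertex `i` itself and its predecessor, if there is one. -/
abbrev Supp (i : Fin n) : Type := {j : Fin n // j = i ∨ j.val + 1 = i.val}

/-- Action of the generators on the standard module at `i`, with basis `Supp i`: its Loewy diagram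
is `i ⟶ i - 1`, the map being given by `α' (i - 1)`, and all other arrows act as zero. -/
def stdGen (i : Fin n) : Gen n → Matrix (Supp i) (Supp i) k
  | .vertex j => Matrix.diagonal fun s => if s.1 = j then 1 else 0
  | .up _ _ => 0
  | .down j _ => Matrix.of fun s t => if s.1.val = j ∧ t.1.val = j + 1 then 1 else 0

/-- Action of the generators on the costandard module at `i`, with basis `Supp i`: its Loewy
diagram is `i - 1 ⟶ i`, the map being given by `α (i - 1)`, and all other arrows act as zero. -/
def costdGen (i : Fin n) : Gen n → Matrix (Supp i) (Supp i) k
  | .vertex j => Matrix.diagonal fun s => if s.1 = j then 1 else 0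
  | .up j _ => Matrix.of fun s t => if s.1.val = j + 1 ∧ t.1.val = j then 1 else 0
  | .down _ _ => 0

theorem stdGen_rel (i : Fin n) ⦃x y : FreeAlgebra k (Gen n)⦄ (h : Rel k n x y) :
    FreeAlgebra.lift k (stdGen k i) x = FreeAlgebra.lift k (stdGen k i) y := by
  cases h
  case down_down j h =>
    ext s u
    simp only [fα', map_mul, FreeAlgebra.lift_ι_apply, stdGen, Matrix.mul_apply, Matrix.of_apply,
      map_zero, Matrix.zero_apply]
    refine Finset.sum_eq_zero fun t _ => ?_
    obtain ⟨s, hs⟩ := s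
    obtain ⟨u, hu⟩ := u
    simp only [Fin.ext_iff] at hs hu
    dsimp only
    split_ifs <;> first | (simp; done) | omega
  case one =>
    ext s u
    simp [fe, stdGen, FreeAlgebra.lift_ι_apply, Matrix.sum_apply, Matrix.diagonal_apply,
      Matrix.one_apply]
  all_goals
    simp only [fe, fα, fα', map_mul, FreeAlgebra.lift_ι_apply, stdGen, map_zero, zero_mul, mul_zero]
  all_goals
    ext s u
    simp only [Matrix.diagonal_mul, Matrix.mul_diagonal, Matrix.diagonal_apply, Matrix.of_apply,
      Matrix.zero_apply, lo, hi, Fin.ext_iff]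
    split_ifs <;> simp_all [Fin.ext_iff]

theorem costdGen_rel (i : Fin n) ⦃x y : FreeAlgebra k (Gen n)⦄ (h : Rel k n x y) :
    FreeAlgebra.lift k (costdGen k i) x = FreeAlgebra.lift k (costdGen k i) y := by
  cases h
  case up_up j h =>
    ext s u
    simp only [fα, map_mul, FreeAlgebra.lift_ι_apply, costdGen, Matrix.mul_apply, Matrix.of_apply,
      map_zero, Matrix.zero_apply]
    refine Finset.sum_eq_zero fun t _ => ?_
    obtain ⟨s, hs⟩ := s
    obtain ⟨u, hu⟩ := u
    simp only [Fin.ext_iff] at hs hu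
    dsimp only
    split_ifs <;> first | (simp; done) | omega
  case one =>
    ext s u
    simp [fe, costdGen, FreeAlgebra.lift_ι_apply, Matrix.sum_apply, Matrix.diagonal_apply,
      Matrix.one_apply]
  all_goals
    simp only [fe, fα, fα', map_mul, FreeAlgebra.lift_ι_apply, costdGen, map_zero, zero_mul,
      mul_zero]
  all_goals
    ext s u
    simp only [Matrix.diagonal_mul, Matrix.mul_diagonal, Matrix.diagonal_apply, Matrix.of_apply,
      Matrix.zero_apply, lo, hi, Fin.ext_iff]
    split_ifs <;> simp_all [Fin.ext_iff]

/-- The representation of `Λ_n` on the standard module at `i`. -/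
noncomputable def stdRep (i : Fin n) : Lam k n →ₐ[k] Module.End k (Supp i → k) :=
  (Matrix.toLinAlgEquiv' : Matrix (Supp i) (Supp i) k ≃ₐ[k] _).toAlgHom.comp
    (RingQuot.liftAlgHom k ⟨FreeAlgebra.lift k (stdGen k i), stdGen_rel k i⟩)

/-- The representation of `Λ_n` on the costandard module at `i`. -/
noncomputable def costdRep (i : Fin n) : Lam k n →ₐ[k] Module.End k (Supp i → k) :=
  (Matrix.toLinAlgEquiv' : Matrix (Supp i) (Supp i) k ≃ₐ[k] _).toAlgHom.comp
    (RingQuot.liftAlgHom k ⟨FreeAlgebra.lift k (costdGen k i), costdGen_rel k i⟩)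

/-- The standard module `Δ(i)`: uniserial with top `L(i)` and, unless `i` is the first vertex,
socle `L(i - 1)`. -/
def Std (i : Fin n) : Type _ := Supp i → k

/-- The costandard module `∇(i)`: uniserial with socle `L(i)` and, unless `i` is the first vertex,
top `L(i - 1)`. -/
def Costd (i : Fin n) : Type _ := Supp i → k

noncomputable instance (i : Fin n) : AddCommGroup (Std k i) :=
  inferInstanceAs (AddCommGroup (Supp i → k))

noncomputable instance (i : Fin n) : AddCommGroup (Costd k i) :=
  inferInstanceAs (AddCommGroup (Supp i → k))

noncomputable instance (i : Fin n) : Module (Lam k n) (Std k i) :=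
  Module.compHom (Supp i → k) (stdRep k i).toRingHom

noncomputable instance (i : Fin n) : Module (Lam k n) (Costd k i) :=
  Module.compHom (Supp i → k) (costdRep k i).toRingHom

end

/-- `M` has a finite filtration `0 = F 0 ≤ F 1 ≤ ⋯ ≤ F r = M` all of whose subquotients are
isomorphic to members of the family `D`. -/
def HasFiltrationBy {R : Type*} [Ring R] {ι : Type*} (D : ι → Type*)
    [∀ i, AddCommGroup (D i)] [∀ i, Module R (D i)]
    (M : Type*) [AddCommGroup M] [Module R M] : Prop :=
  ∃ (r : ℕ) (F : ℕ → Submodule R M), F 0 = ⊥ ∧ F r = ⊤ ∧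
    ∀ s < r, F s ≤ F (s + 1) ∧
      ∃ i : ι, Nonempty ((F (s + 1) ⧸ (F s).submoduleOf (F (s + 1))) ≃ₗ[R] D i)

/-- `M` has a standard filtration, i.e. `M ∈ 𝓕(Δ)`. -/
def HasStandardFiltration (k : Type*) [Field k] (n : ℕ)
    (M : Type*) [AddCommGroup M] [Module (Lam k n) M] : Prop :=
  HasFiltrationBy (R := Lam k n) (fun i : Fin n => Std k i) M

/-- `M` has a costandard filtration, i.e. `M ∈ 𝓕(∇)`. -/
def HasCostandardFiltration (k : Type*) [Field k] (n : ℕ)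
    (M : Type*) [AddCommGroup M] [Module (Lam k n) M] : Prop :=
  HasFiltrationBy (R := Lam k n) (fun i : Fin n => Costd k i) M

/-- `M` is self-orthogonal: `Ext^m(M, M) = 0` for all `m > 0`. -/
def IsSelfOrthogonal (R : Type u) [Ring R] (M : Type u) [AddCommGroup M] [Module R M] : Prop :=
  ∀ m : ℕ, 0 < m →
    Subsingleton (CategoryTheory.Abelian.Ext (ModuleCat.of R M) (ModuleCat.of R M) m)

end DualExtension

/-!
Write `a` for the sum of the arrows `α i` and `b` for the sum of the arrows `α' i` (`raise` and
`lower` below). A `Λ_n`-module is a vector space graded by the vertices with a differential `a` of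
degree `1` and a differential `b` of degree `-1` such that `ab = 0`. The theorem is about the
homology of these two differentials away from the first vertex.

If the homology of `b` vanishes away from the first vertex, then a finite-dimensional `M` has a
standard filtration: a nonzero vector at the largest vertex `i` of the support generates a copy of
`Δ(i)`, and the quotient satisfies the same hypothesis (`LowerExact.hasStandardFiltration`).
Dually, a linear form at the largest vertex yields a quotient `∇(i)`, and if the cohomology of `a`
vanishes away from the first vertex, then `M` has a costandard filtration
(`RaiseExact.hasCostandardFiltration`). So a module with neither filtration has a `b`-homology
class at some vertex `v ≥ 2` and an `a`-cohomology class at some vertex `u ≥ 2`, and it remains to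
see that, for all modules `M` and `N`, a `b`-homology class of `M` at `v` and an `a`-cohomology
class of `N` at `u` force `Ext^(u+v-2)(M, N) ≠ 0` (`HasLowerClass.not_subsingleton_ext`).

This is dimension shifting. From the basis `e i`, `α i`, `α' i`, `α' i α i` of `Λ_n` one reads off
that free modules have no `b`-homology, and injective modules no `a`-cohomology, away from the first
vertex (`lowerExact_lam`, `raiseExact_of_injective`).

* Embed `N` in an injective module with cokernel `C`. The connecting map carries the class of `N`
  at `u` to a class of `C` at `u - 1`. For `u = 2` the latter is a map `L(1) ⟶ C` which does not
  lift to the injective module. By induction, `Ext^(u-1)(L(1), N) ≠ 0`.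
* Let `K` be the kernel of a surjection from a free module onto `M`. The connecting map carries the
  class of `M` at `v` to a class of `K` at `v - 1`. For `v = 2` it is represented by a vector of the
  form `b w`, which is killed by `a` since `ab = 0`; hence `K` has `L(1)` as a direct summand, and
  `Ext^u(M, N) ≅ Ext^(u-1)(K, N)` contains `Ext^(u-1)(L(1), N)`. Larger `v` follow by induction.
-/

namespace DualExtension

/-! ### Generators of `Λ_n` and the two differentials -/

section Generators

variable (k : Type*) [Field k] (n : ℕ)

/-- The idempotent of `Λ_n` at the vertex with value `i`; it is `0` if there is no such vertex. -/
noncomputable def idem (i : ℕ) : Lam k n :=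
  if h : i < n then RingQuot.mkAlgHom k (Rel k n) (fe k n ⟨i, h⟩) else 0

/-- The arrow `α i` as an element of `Λ_n`; it is `0` if there is no such arrow. -/
noncomputable def up (i : ℕ) : Lam k n :=
  if h : i + 1 < n then RingQuot.mkAlgHom k (Rel k n) (fα k n i h) else 0

/-- The arrow `α' i` as an element of `Λ_n`; it is `0` if there is no such arrow. -/
noncomputable def down (i : ℕ) : Lam k n :=
  if h : i + 1 < n then RingQuot.mkAlgHom k (Rel k n) (fα' k n i h) else 0

/-- The sum of all arrows `α i`. On a module it is a differential raising the vertex by one. -/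
noncomputable def raise : Lam k n := ∑ i ∈ Finset.range n, up k n i

/-- The sum of all arrows `α' i`. On a module it is a differential lowering the vertex by one. -/
noncomputable def lower : Lam k n := ∑ i ∈ Finset.range n, down k n i

variable {k n}

theorem idem_mul_idem (i j : ℕ) : idem k n i * idem k n j = if i = j then idem k n i else 0 := by
  unfold idem
  split_ifs with h₁ h₂ h h h
  · subst h
    rw [← map_mul, RingQuot.mkAlgHom_rel k (Rel.idem _)]
  · rw [← map_mul, RingQuot.mkAlgHom_rel k (Rel.orth _ _ (by simpa [Fin.ext_iff] using h)),
      map_zero]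
  · omega
  all_goals simp

@[simp]
theorem idem_mul_self (i : ℕ) : idem k n i * idem k n i = idem k n i := by
  simp [idem_mul_idem]

theorem idem_mul_of_ne {i j : ℕ} (h : i ≠ j) : idem k n i * idem k n j = 0 := by
  simp [idem_mul_idem, h]

theorem idem_of_le {i : ℕ} (h : n ≤ i) : idem k n i = 0 := by
  simp [idem, Nat.not_lt.2 h]

variable (k n) in
theorem sum_idem : ∑ i ∈ Finset.range n, idem k n i = 1 := by
  rw [← map_one (RingQuot.mkAlgHom k (Rel k n)), ← RingQuot.mkAlgHom_rel k (Rel.one (k := k)),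
    map_sum, Finset.sum_range]
  simp [idem]

theorem up_mul_idem (i : ℕ) : up k n i * idem k n i = up k n i := by
  unfold up idem
  split_ifs with h₁ h₂
  · rw [← map_mul]
    exact RingQuot.mkAlgHom_rel k (Rel.up_src i h₁)
  · omega
  all_goals simp

theorem idem_mul_up (i : ℕ) : idem k n (i + 1) * up k n i = up k n i := by
  unfold up idem
  split_ifs with h₁
  · rw [← map_mul]
    exact RingQuot.mkAlgHom_rel k (Rel.up_tgt i h₁)
  all_goals simp

theorem down_mul_idem (i : ℕ) : down k n i * idem k n (i + 1) = down k n i := by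
  unfold down idem
  split_ifs with h₁
  · rw [← map_mul]
    exact RingQuot.mkAlgHom_rel k (Rel.down_src i h₁)
  all_goals simp

theorem idem_mul_down (i : ℕ) : idem k n i * down k n i = down k n i := by
  by_cases h : i + 1 < n
  · rw [down, idem, dif_pos h, dif_pos (Nat.lt_of_succ_lt h), ← map_mul]
    exact RingQuot.mkAlgHom_rel k (Rel.down_tgt i h)
  · simp [down, h]

theorem up_mul_up (i : ℕ) : up k n (i + 1) * up k n i = 0 := by
  unfold up
  split_ifs with h₁
  · rw [← map_mul, RingQuot.mkAlgHom_rel k (Rel.up_up i h₁), map_zero]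
  all_goals simp

theorem down_mul_down (i : ℕ) : down k n i * down k n (i + 1) = 0 := by
  unfold down
  split_ifs with h₁ h₂
  · rw [← map_mul, RingQuot.mkAlgHom_rel k (Rel.down_down i h₂), map_zero]
  all_goals simp

theorem up_mul_down (i : ℕ) : up k n i * down k n i = 0 := by
  unfold up down
  split_ifs with h₁
  · rw [← map_mul, RingQuot.mkAlgHom_rel k (Rel.up_down i h₁), map_zero]
  all_goals simp

theorem up_of_le {i : ℕ} (h : n ≤ i) : up k n i = 0 := by
  rw [up, dif_neg (by omega)]

theorem down_of_le {i : ℕ} (h : n ≤ i) : down k n i = 0 := by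
  rw [down, dif_neg (by omega)]

theorem raise_mul_idem (i : ℕ) : raise k n * idem k n i = up k n i := by
  rcases lt_or_ge i n with h | h
  · rw [raise, Finset.sum_mul, Finset.sum_eq_single_of_mem i (Finset.mem_range.2 h), up_mul_idem]
    intro j _ hj
    rw [← up_mul_idem, mul_assoc, idem_mul_of_ne hj, mul_zero]
  · rw [idem_of_le h, up_of_le h, mul_zero]

theorem idem_succ_mul_raise (i : ℕ) : idem k n (i + 1) * raise k n = up k n i := by
  rcases lt_or_ge i n with h | h
  · rw [raise, Finset.mul_sum, Finset.sum_eq_single_of_mem i (Finset.mem_range.2 h), idem_mul_up]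
    intro j _ hj
    rw [← idem_mul_up, ← mul_assoc, idem_mul_of_ne (by omega), zero_mul]
  · rw [idem_of_le (by omega), up_of_le h, zero_mul]

@[simp]
theorem idem_zero_mul_raise : idem k n 0 * raise k n = 0 := by
  rw [raise, Finset.mul_sum]
  refine Finset.sum_eq_zero fun j _ => ?_
  rw [← idem_mul_up, ← mul_assoc, idem_mul_of_ne (by omega), zero_mul]

theorem idem_mul_lower (i : ℕ) : idem k n i * lower k n = down k n i := by
  rcases lt_or_ge i n with h | h
  · rw [lower, Finset.mul_sum, Finset.sum_eq_single_of_mem i (Finset.mem_range.2 h),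
      idem_mul_down]
    intro j _ hj
    rw [← idem_mul_down, ← mul_assoc, idem_mul_of_ne hj.symm, zero_mul]
  · rw [idem_of_le h, down_of_le h, zero_mul]

theorem lower_mul_idem_succ (i : ℕ) : lower k n * idem k n (i + 1) = down k n i := by
  rcases lt_or_ge i n with h | h
  · rw [lower, Finset.sum_mul, Finset.sum_eq_single_of_mem i (Finset.mem_range.2 h),
      down_mul_idem]
    intro j _ hj
    rw [← down_mul_idem, mul_assoc, idem_mul_of_ne (by omega), mul_zero]
  · rw [idem_of_le (by omega), down_of_le h, mul_zero]

@[simp]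
theorem lower_mul_idem_zero : lower k n * idem k n 0 = 0 := by
  rw [lower, Finset.sum_mul]
  refine Finset.sum_eq_zero fun j _ => ?_
  rw [← down_mul_idem, mul_assoc, idem_mul_of_ne (by omega), mul_zero]

theorem mul_eq_sum_mul_idem_mul (x y : Lam k n) :
    x * y = ∑ i ∈ Finset.range n, x * idem k n i * y := by
  rw [← Finset.sum_mul, ← Finset.mul_sum, sum_idem, mul_one]

@[simp]
theorem raise_mul_raise : raise k n * raise k n = 0 := by
  rw [mul_eq_sum_mul_idem_mul]
  refine Finset.sum_eq_zero fun i _ => ?_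
  rcases i with _ | i
  · rw [mul_assoc, idem_zero_mul_raise, mul_zero]
  · rw [← idem_mul_self, ← mul_assoc, raise_mul_idem, mul_assoc, idem_succ_mul_raise, up_mul_up]

@[simp]
theorem lower_mul_lower : lower k n * lower k n = 0 := by
  rw [mul_eq_sum_mul_idem_mul]
  refine Finset.sum_eq_zero fun i _ => ?_
  rcases i with _ | i
  · rw [lower_mul_idem_zero, zero_mul]
  · rw [← idem_mul_self, ← mul_assoc, lower_mul_idem_succ, mul_assoc, idem_mul_lower,
      down_mul_down]

@[simp]
theorem raise_mul_lower : raise k n * lower k n = 0 := by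
  rw [mul_eq_sum_mul_idem_mul]
  refine Finset.sum_eq_zero fun i _ => ?_
  rw [← idem_mul_self, ← mul_assoc, raise_mul_idem, mul_assoc, idem_mul_lower, up_mul_down]

theorem idem_succ_mul_raise_comm (i : ℕ) :
    idem k n (i + 1) * raise k n = raise k n * idem k n i := by
  rw [idem_succ_mul_raise, raise_mul_idem]

theorem idem_mul_lower_comm (i : ℕ) :
    idem k n i * lower k n = lower k n * idem k n (i + 1) := by
  rw [idem_mul_lower, lower_mul_idem_succ]

/-- `Λ_n` is generated by the idempotents and the two differentials `raise` and `lower`. -/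
theorem lam_induction {p : Lam k n → Prop} (algebraMap : ∀ c : k, p (algebraMap k _ c))
    (idem : ∀ i, p (idem k n i)) (raise : p (raise k n)) (lower : p (lower k n))
    (add : ∀ x y, p x → p y → p (x + y)) (mul : ∀ x y, p x → p y → p (x * y)) (x : Lam k n) :
    p x := by
  obtain ⟨x, rfl⟩ := RingQuot.mkAlgHom_surjective k (Rel k n) x
  induction x using FreeAlgebra.induction with
  | grade0 c => simpa using algebraMap c
  | grade1 g =>
    cases g with
    | vertex i => simpa [DualExtension.idem, fe] using idem i
    | up i h => simpa [raise_mul_idem, up, h, fα] using mul _ _ raise (idem i)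
    | down i h => simpa [idem_mul_lower, down, h, fα'] using mul _ _ (idem i) lower
  | mul x y hx hy => simpa using mul _ _ hx hy
  | add x y hx hy => simpa using add _ _ hx hy

end Generators

section ModuleLemmas

variable {k : Type*} [Field k] {n : ℕ} {M : Type*} [AddCommGroup M] [Module (Lam k n) M]

@[simp]
theorem idem_smul_idem_smul_self (i : ℕ) (x : M) :
    idem k n i • idem k n i • x = idem k n i • x := by
  rw [smul_smul, idem_mul_self]

theorem idem_smul_idem_smul_of_ne {i j : ℕ} (h : i ≠ j) (x : M) :
    idem k n i • idem k n j • x = 0 := by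
  rw [smul_smul, idem_mul_of_ne h, zero_smul]

@[simp]
theorem raise_smul_raise_smul (x : M) : raise k n • raise k n • x = 0 := by
  rw [smul_smul, raise_mul_raise, zero_smul]

@[simp]
theorem lower_smul_lower_smul (x : M) : lower k n • lower k n • x = 0 := by
  rw [smul_smul, lower_mul_lower, zero_smul]

@[simp]
theorem raise_smul_lower_smul (x : M) : raise k n • lower k n • x = 0 := by
  rw [smul_smul, raise_mul_lower, zero_smul]

@[simp]
theorem idem_zero_smul_raise_smul (x : M) : idem k n 0 • raise k n • x = 0 := by
  rw [smul_smul, idem_zero_mul_raise, zero_smul]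

@[simp]
theorem lower_smul_idem_zero_smul (x : M) : lower k n • idem k n 0 • x = 0 := by
  rw [smul_smul, lower_mul_idem_zero, zero_smul]

theorem idem_succ_smul_raise_smul (i : ℕ) (x : M) :
    idem k n (i + 1) • raise k n • x = raise k n • idem k n i • x := by
  rw [smul_smul, smul_smul, idem_succ_mul_raise_comm]

theorem idem_smul_lower_smul (i : ℕ) (x : M) :
    idem k n i • lower k n • x = lower k n • idem k n (i + 1) • x := by
  rw [smul_smul, smul_smul, idem_mul_lower_comm]

theorem sum_idem_smul (x : M) : ∑ i ∈ Finset.range n, idem k n i • x = x := by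
  rw [← Finset.sum_smul, sum_idem, one_smul]

/-- A `k`-linear map commuting with the generators of `Λ_n` is `Λ_n`-linear. -/
def lamLinearMap [Module k M] [IsScalarTower k (Lam k n) M] {N : Type*} [AddCommGroup N]
    [Module (Lam k n) N] [Module k N] [IsScalarTower k (Lam k n) N] (f : M →ₗ[k] N)
    (idem : ∀ i x, f (idem k n i • x) = idem k n i • f x)
    (raise : ∀ x, f (raise k n • x) = raise k n • f x)
    (lower : ∀ x, f (lower k n • x) = lower k n • f x) : M →ₗ[Lam k n] N where
  toFun := f
  map_add' := map_add f
  map_smul' a := by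
    induction a using lam_induction with
    | algebraMap c => intro x; simp [algebraMap_smul]
    | idem i => exact idem i
    | raise => exact raise
    | lower => exact lower
    | add x y hx hy => intro z; simp only [RingHom.id_apply] at hx hy ⊢; simp [add_smul, hx, hy]
    | mul x y hx hy => intro z; simp only [RingHom.id_apply] at hx hy ⊢; simp [mul_smul, hx, hy]

@[simp]
theorem lamLinearMap_apply [Module k M] [IsScalarTower k (Lam k n) M] {N : Type*} [AddCommGroup N]
    [Module (Lam k n) N] [Module k N] [IsScalarTower k (Lam k n) N] (f : M →ₗ[k] N)
    (h₁ : ∀ i x, f (idem k n i • x) = idem k n i • f x)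
    (h₂ : ∀ x, f (raise k n • x) = raise k n • f x)
    (h₃ : ∀ x, f (lower k n • x) = lower k n • f x) (x : M) :
    lamLinearMap f h₁ h₂ h₃ x = f x := rfl

end ModuleLemmas

/-! ### Coordinates on the standard and costandard modules -/

section StandardModules

variable {k : Type*} [Field k] {n : ℕ}

noncomputable instance (i : Fin n) : Module k (Std k i) :=
  inferInstanceAs (Module k (Supp i → k))

noncomputable instance (i : Fin n) : Module k (Costd k i) :=
  inferInstanceAs (Module k (Supp i → k))

variable (i : Fin n)

/-- The coordinates of an element of `Δ(i)` with respect to its standard basis. -/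
noncomputable def stdCoord : Std k i ≃ₗ[k] (Supp i → k) := LinearEquiv.refl k (Supp i → k)

/-- The coordinates of an element of `∇(i)` with respect to its standard basis. -/
noncomputable def costdCoord : Costd k i ≃ₗ[k] (Supp i → k) := LinearEquiv.refl k (Supp i → k)

variable {i}

theorem stdCoord_smul (a : Lam k n) (v : Std k i) :
    stdCoord i (a • v) = stdRep k i a (stdCoord i v) := rfl

theorem costdCoord_smul (a : Lam k n) (v : Costd k i) :
    costdCoord i (a • v) = costdRep k i a (costdCoord i v) := rfl

instance (i : Fin n) : IsScalarTower k (Lam k n) (Std k i) where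
  smul_assoc c a v := (stdCoord i).injective <| by
    rw [stdCoord_smul, map_smul, map_smul, stdCoord_smul, LinearMap.smul_apply]

instance (i : Fin n) : IsScalarTower k (Lam k n) (Costd k i) where
  smul_assoc c a v := (costdCoord i).injective <| by
    rw [costdCoord_smul, map_smul, map_smul, costdCoord_smul, LinearMap.smul_apply]

theorem stdRep_mkAlgHom (g : Gen n) (v : Supp i → k) :
    stdRep k i (RingQuot.mkAlgHom k (Rel k n) (FreeAlgebra.ι k g)) v =
      (stdGen k i g).mulVec v := by
  simp [stdRep]

theorem costdRep_mkAlgHom (g : Gen n) (v : Supp i → k) :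
    costdRep k i (RingQuot.mkAlgHom k (Rel k n) (FreeAlgebra.ι k g)) v =
      (costdGen k i g).mulVec v := by
  simp [costdRep]

theorem stdCoord_idem_smul (j : ℕ) (v : Std k i) (s : Supp i) :
    stdCoord i (idem k n j • v) s = if s.1.val = j then stdCoord i v s else 0 := by
  rw [stdCoord_smul, idem]
  split_ifs with h₁ h₂ h₂
  · simp [fe, stdRep_mkAlgHom, stdGen, Matrix.mulVec_diagonal, Fin.ext_iff, h₂]
  · simp [fe, stdRep_mkAlgHom, stdGen, Matrix.mulVec_diagonal, Fin.ext_iff, h₂]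
  · have := s.1.2; omega
  · simp

theorem costdCoord_idem_smul (j : ℕ) (v : Costd k i) (s : Supp i) :
    costdCoord i (idem k n j • v) s = if s.1.val = j then costdCoord i v s else 0 := by
  rw [costdCoord_smul, idem]
  split_ifs with h₁ h₂ h₂
  · simp [fe, costdRep_mkAlgHom, costdGen, Matrix.mulVec_diagonal, Fin.ext_iff, h₂]
  · simp [fe, costdRep_mkAlgHom, costdGen, Matrix.mulVec_diagonal, Fin.ext_iff, h₂]
  · have := s.1.2; omega
  · simp

@[simp]
theorem std_raise_smul (v : Std k i) : raise k n • v = 0 := by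
  rw [raise, Finset.sum_smul]
  refine Finset.sum_eq_zero fun j _ => (stdCoord i).injective ?_
  rw [stdCoord_smul, up, map_zero]
  split_ifs with h
  · rw [fα, stdRep_mkAlgHom, stdGen, Matrix.zero_mulVec]
  · rw [map_zero, LinearMap.zero_apply]

@[simp]
theorem costd_lower_smul (v : Costd k i) : lower k n • v = 0 := by
  rw [lower, Finset.sum_smul]
  refine Finset.sum_eq_zero fun j _ => (costdCoord i).injective ?_
  rw [costdCoord_smul, down, map_zero]
  split_ifs with h
  · rw [fα', costdRep_mkAlgHom, costdGen, Matrix.zero_mulVec]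
  · rw [map_zero, LinearMap.zero_apply]

variable (i) in
/-- The coordinate of an element of `Δ(i)` at the vertex `i`. -/
noncomputable def stdTop : Std k i →ₗ[k] k :=
  LinearMap.proj (⟨i, Or.inl rfl⟩ : Supp i) ∘ₗ (stdCoord i).toLinearMap

variable (i) in
/-- The coordinate of an element of `Δ(i)` at the vertex preceding `i`; it is `0` if `i` is the
first vertex. -/
noncomputable def stdBot : Std k i →ₗ[k] k :=
  (if h : 0 < i.val then
    LinearMap.proj (⟨⟨i - 1, by omega⟩, Or.inr (by simp; omega)⟩ : Supp i) else 0) ∘ₗ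
      (stdCoord i).toLinearMap

theorem stdBot_apply (h : 0 < i.val) (v : Std k i) :
    stdBot i v = stdCoord i v ⟨⟨i - 1, by omega⟩, Or.inr (by simp; omega)⟩ := by
  simp [stdBot, h]

theorem stdBot_of_eq_zero (h : i.val = 0) (v : Std k i) : stdBot i v = 0 := by
  simp [stdBot, h]

theorem std_ext {v w : Std k i} (h₁ : stdTop i v = stdTop i w) (h₂ : stdBot i v = stdBot i w) :
    v = w := by
  refine (stdCoord i).injective (funext fun s => ?_)
  obtain ⟨s, rfl | hs⟩ := s
  · exact h₁
  · have h : 0 < i.val := by omega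
    have hs' : s = ⟨i - 1, by omega⟩ := Fin.ext (by simp; omega)
    simpa [stdBot_apply h, ← hs'] using h₂

theorem stdTop_idem_smul (j : ℕ) (v : Std k i) :
    stdTop i (idem k n j • v) = if i.val = j then stdTop i v else 0 :=
  stdCoord_idem_smul j v _

theorem stdBot_idem_smul (j : ℕ) (v : Std k i) :
    stdBot i (idem k n j • v) = if i.val = j + 1 then stdBot i v else 0 := by
  rcases Nat.eq_zero_or_pos i.val with h | h
  · simp [stdBot_of_eq_zero h]
  · rw [stdBot_apply h, stdBot_apply h, stdCoord_idem_smul]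
    exact if_congr (by simp; omega) rfl rfl

theorem stdCoord_down_smul (j : ℕ) (v : Std k i) (s : Supp i) :
    stdCoord i (down k n j • v) s = if s.1.val = j ∧ i.val = j + 1 then stdTop i v else 0 := by
  rw [stdCoord_smul, down]
  split_ifs with h₁ h₂ h₂
  · rw [fα', stdRep_mkAlgHom, Matrix.mulVec, dotProduct,
      Finset.sum_eq_single (⟨i, Or.inl rfl⟩ : Supp i)]
    · simp [stdGen, h₂, stdTop]
    · rintro ⟨t, rfl | ht⟩ _ hne
      · exact absurd rfl hne
      · have : t.val ≠ j + 1 := by omega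
        simp [stdGen, this]
    · simp
  · rw [fα', stdRep_mkAlgHom, Matrix.mulVec, dotProduct]
    refine Finset.sum_eq_zero fun t _ => ?_
    have : ¬ (s.1.val = j ∧ t.1.val = j + 1) := by
      have := t.2
      have := s.2
      simp only [Fin.ext_iff] at *
      omega
    simp [stdGen, this]
  · have := i.2; omega
  · simp

theorem stdCoord_lower_smul (v : Std k i) (s : Supp i) :
    stdCoord i (lower k n • v) s = if s.1.val + 1 = i.val then stdTop i v else 0 := by
  have h : stdCoord i (idem k n s.1.val • lower k n • v) s = stdCoord i (lower k n • v) s := by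
    rw [stdCoord_idem_smul, if_pos rfl]
  rw [← h, smul_smul, idem_mul_lower, stdCoord_down_smul]
  simp [eq_comm]

@[simp]
theorem stdTop_lower_smul (v : Std k i) : stdTop i (lower k n • v) = 0 :=
  (stdCoord_lower_smul v _).trans (if_neg (by simp))

theorem stdBot_lower_smul (h : 0 < i.val) (v : Std k i) :
    stdBot i (lower k n • v) = stdTop i v := by
  rw [stdBot_apply h]
  exact (stdCoord_lower_smul v _).trans (if_pos (by simp; omega))

variable (i) in
/-- The element of `Δ(i)` with coordinate `c` at the vertex `i` and coordinate `0` elsewhere. -/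
noncomputable def stdOfTop : k →ₗ[k] Std k i :=
  (stdCoord i).symm.toLinearMap ∘ₗ LinearMap.single k (fun _ => k) (⟨i, Or.inl rfl⟩ : Supp i)

@[simp]
theorem stdTop_stdOfTop (c : k) : stdTop i (stdOfTop i c) = c := by
  simp [stdTop, stdOfTop]

@[simp]
theorem stdBot_stdOfTop (c : k) : stdBot i (stdOfTop i c) = 0 := by
  rcases Nat.eq_zero_or_pos i.val with h | h
  · exact stdBot_of_eq_zero h _
  · rw [stdBot_apply h, stdOfTop, LinearMap.comp_apply, LinearEquiv.coe_coe,
      LinearEquiv.apply_symm_apply]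
    refine Pi.single_eq_of_ne (fun he => ?_) _
    have := congrArg (fun s => s.1.val) he
    simp at this
    omega

variable (i) in
/-- The element of `∇(i)` whose coordinates at the vertex `i` and at the vertex preceding `i` are
the components of `c`. -/
noncomputable def costdMk : k × k →ₗ[k] Costd k i :=
  (costdCoord i).symm.toLinearMap ∘ₗ
    LinearMap.pi fun s => if s.1 = i then LinearMap.fst k k k else LinearMap.snd k k k

theorem costdCoord_costdMk (c : k × k) (s : Supp i) :
    costdCoord i (costdMk i c) s = if s.1 = i then c.1 else c.2 := by
  simp only [costdMk, LinearMap.comp_apply, LinearEquiv.coe_coe, LinearEquiv.apply_symm_apply,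
    LinearMap.pi_apply]
  split_ifs <;> rfl

theorem idem_smul_costdMk (j : ℕ) (c : k × k) :
    idem k n j • costdMk i c =
      costdMk i (if i.val = j then c.1 else 0, if i.val = j + 1 then c.2 else 0) := by
  refine (costdCoord i).injective (funext fun s => ?_)
  rw [costdCoord_idem_smul, costdCoord_costdMk, costdCoord_costdMk]
  obtain ⟨s, rfl | hs⟩ := s
  · simp
  · have h : s ≠ i := by rintro rfl; omega
    simp only [h, if_false]
    exact if_congr (by omega) rfl rfl

theorem costdCoord_up_smul (j : ℕ) (c : k × k) (s : Supp i) :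
    costdCoord i (up k n j • costdMk i c) s =
      if s.1.val = j + 1 ∧ i.val = j + 1 then c.2 else 0 := by
  rw [costdCoord_smul, up]
  split_ifs with h₁ h₂ h₂
  · rw [fα, costdRep_mkAlgHom, Matrix.mulVec, dotProduct,
      Finset.sum_eq_single (⟨⟨j, by omega⟩, Or.inr h₂.2.symm⟩ : Supp i)]
    · have : (⟨j, by omega⟩ : Fin n) ≠ i := fun h => by
        have := congrArg Fin.val h; simp at this; omega
      simp [costdGen, h₂, costdCoord_costdMk, this]
    · rintro ⟨t, ht⟩ _ hne
      have : t.val ≠ j := fun h => hne (Subtype.ext (Fin.ext h))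
      simp [costdGen, this]
    · simp
  · rw [fα, costdRep_mkAlgHom, Matrix.mulVec, dotProduct]
    refine Finset.sum_eq_zero fun t _ => ?_
    have : ¬ (s.1.val = j + 1 ∧ t.1.val = j) := by
      have := t.2
      have := s.2
      simp only [Fin.ext_iff] at *
      omega
    simp [costdGen, this]
  · have := i.2; omega
  · simp

theorem raise_smul_costdMk (c : k × k) (h : i.val = 0 → c.2 = 0) :
    raise k n • costdMk i c = costdMk i (c.2, 0) := by
  refine (costdCoord i).injective (funext fun s => ?_)
  have hs : costdCoord i (idem k n s.1.val • raise k n • costdMk i c) s =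
      costdCoord i (raise k n • costdMk i c) s := by
    rw [costdCoord_idem_smul, if_pos rfl]
  rw [← hs, smul_smul, costdCoord_costdMk]
  obtain ⟨⟨_ | s, hsn⟩, hs'⟩ := s
  · simp only [idem_zero_mul_raise, zero_smul, map_zero, Pi.zero_apply, Fin.ext_iff]
    split_ifs with h'
    · exact (h h'.symm).symm
    · rfl
  · simp only [idem_succ_mul_raise]
    rw [costdCoord_up_smul]
    simp [Fin.ext_iff, eq_comm]

theorem exists_eq_costdMk (v : Costd k i) :
    ∃ c : k × k, (i.val = 0 → c.2 = 0) ∧ costdMk i c = v := by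
  rcases Nat.eq_zero_or_pos i.val with h | h
  · refine ⟨(costdCoord i v ⟨i, Or.inl rfl⟩, 0), fun _ => rfl,
      (costdCoord i).injective (funext fun s => ?_)⟩
    rw [costdCoord_costdMk]
    obtain ⟨s, rfl | hs⟩ := s
    · simp
    · omega
  · refine ⟨(costdCoord i v ⟨i, Or.inl rfl⟩,
      costdCoord i v ⟨⟨i - 1, by omega⟩, Or.inr (by simp; omega)⟩), by omega,
      (costdCoord i).injective (funext fun s => ?_)⟩
    rw [costdCoord_costdMk]
    obtain ⟨s, rfl | hs⟩ := s
    · simp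
    · have hs' : s = ⟨i - 1, by omega⟩ := Fin.ext (by simp; omega)
      have : s ≠ i := by rintro rfl; omega
      simp [this, ← hs']

end StandardModules

/-! ### Exact modules have filtrations -/

section Exactness

variable (k : Type*) [Field k] (n : ℕ)

/-- The complex `(M, lower)` is exact away from the first vertex. The cycle `z` need not be
concentrated at one vertex, but it has no component at the first one. -/
def LowerExact (M : Type*) [AddCommGroup M] [Module (Lam k n) M] : Prop :=
  ∀ z : M, idem k n 0 • z = 0 → lower k n • z = 0 → ∃ w : M, lower k n • w = z

/-- The complex `(M, raise)` is exact away from the first vertex. The cocycle `z` need not be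
concentrated at one vertex, but it has no component at the first one. -/
def RaiseExact (M : Type*) [AddCommGroup M] [Module (Lam k n) M] : Prop :=
  ∀ z : M, idem k n 0 • z = 0 → raise k n • z = 0 → ∃ w : M, raise k n • w = z

variable {k n}

theorem LowerExact.of_equiv {M N : Type*} [AddCommGroup M] [Module (Lam k n) M] [AddCommGroup N]
    [Module (Lam k n) N] (e : M ≃ₗ[Lam k n] N) (h : LowerExact k n M) : LowerExact k n N := by
  intro z h₀ hz
  obtain ⟨w, hw⟩ := h (e.symm z) (by rw [← map_smul, h₀, map_zero])
    (by rw [← map_smul, hz, map_zero])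
  exact ⟨e w, by rw [← map_smul, hw, e.apply_symm_apply]⟩

end Exactness

section Steps

variable {k : Type*} [Field k] {n : ℕ} {M : Type*} [AddCommGroup M] [Module (Lam k n) M]

variable (k n M) in
/-- A nonzero module has a largest vertex in its support. -/
theorem exists_max_vertex [Nontrivial M] : ∃ (i : Fin n) (x : M), x ≠ 0 ∧ idem k n i • x = x ∧
    ∀ (j : ℕ) (y : M), i < j → idem k n j • y = 0 := by
  classical
  let p : ℕ → Prop := fun i => ∃ x : M, idem k n i • x ≠ 0
  have hp : ∃ i, p i := by
    obtain ⟨x, hx⟩ := exists_ne (0 : M)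
    by_contra! hc
    refine hx ?_
    rw [← sum_idem_smul (k := k) (n := n) x]
    exact Finset.sum_eq_zero fun i _ => by_contra fun h => hc i ⟨x, h⟩
  have hlt : ∀ i, p i → i < n := fun i ⟨x, hx⟩ => by
    by_contra! h
    exact hx (by rw [idem_of_le h, zero_smul])
  obtain ⟨i₀, hi₀⟩ := hp
  have hs := Nat.findGreatest_spec (P := p) (hlt i₀ hi₀).le hi₀
  set i := Nat.findGreatest p n
  obtain ⟨x, hx⟩ := hs
  refine ⟨⟨i, hlt i ⟨x, hx⟩⟩, idem k n i • x, hx, idem_smul_idem_smul_self i x, ?_⟩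
  intro j y hj
  by_contra h
  have : j ≤ i := Nat.le_findGreatest (hlt j ⟨y, h⟩).le ⟨y, h⟩
  exact absurd hj (by simpa using this)

theorem raise_smul_eq_zero_of_max {i : ℕ} (hmax : ∀ (j : ℕ) (y : M), i < j → idem k n j • y = 0)
    {x : M} (hx : idem k n i • x = x) : raise k n • x = 0 := by
  rw [← hx, ← idem_succ_smul_raise_smul, hmax _ _ (Nat.lt_succ_self i)]

/-- If `(M, lower)` is exact away from the first vertex, then a nonzero vector `x` at the largest
vertex `i` of the support generates a copy of `Δ(i)`, and exactness passes to the quotient. -/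
theorem LowerExact.exists_std [Module k M] [IsScalarTower k (Lam k n) M] [Nontrivial M]
    (h : LowerExact k n M) : ∃ (i : Fin n) (f : Std k i →ₗ[Lam k n] M), Function.Injective f ∧
      LowerExact k n (M ⧸ LinearMap.range f) := by
  obtain ⟨i, x, hx₀, hx, hmax⟩ := exists_max_vertex k n M
  have hrx : raise k n • x = 0 := raise_smul_eq_zero_of_max hmax hx
  have hcomm : ∀ (c : k) (a : Lam k n) (y : M), a • c • y = c • a • y := fun c a y =>
    smul_comm a c y
  have hlx : i.val = 0 → lower k n • x = 0 := fun h0 => by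
    rw [← hx, h0, lower_smul_idem_zero_smul]
  let f₀ : Std k i →ₗ[k] M := (stdTop i).smulRight x + (stdBot i).smulRight (lower k n • x)
  have hf₀ : ∀ v, f₀ v = stdTop i v • x + stdBot i v • lower k n • x := fun v => rfl
  have hix : ∀ j, idem k n j • x = if i.val = j then x else 0 := fun j => by
    split_ifs with hj
    · rw [← hj, hx]
    · rw [← hx, idem_smul_idem_smul_of_ne (Ne.symm hj)]
  have hil : ∀ j, idem k n j • lower k n • x = if i.val = j + 1 then lower k n • x else 0 :=
    fun j => by
      rw [idem_smul_lower_smul, hix]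
      split_ifs <;> simp
  let f : Std k i →ₗ[Lam k n] M := lamLinearMap f₀
    (fun j v => by
      rw [hf₀, hf₀, stdTop_idem_smul, stdBot_idem_smul, smul_add, hcomm, hcomm, hix, hil]
      split_ifs <;> simp)
    (fun v => by simp [hf₀, hcomm, hrx])
    (fun v => by
      rw [hf₀, hf₀, stdTop_lower_smul, smul_add, hcomm, hcomm, lower_smul_lower_smul]
      rcases Nat.eq_zero_or_pos i.val with h0 | h0
      · simp [hlx h0]
      · simp [stdBot_lower_smul h0])
  have hf : ∀ v, f v = stdTop i v • x + stdBot i v • lower k n • x := fun v => rfl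
  have hlx' : 0 < i.val → lower k n • x ≠ 0 := fun h0 hl => by
    obtain ⟨y, hy⟩ := h x (by rw [hix, if_neg h0.ne']) hl
    refine hx₀ ?_
    rw [← hx, ← hy, idem_smul_lower_smul, hmax _ _ (Nat.lt_succ_self _), smul_zero]
  refine ⟨i, f, ?_, ?_⟩
  · rw [← LinearMap.ker_eq_bot, LinearMap.ker_eq_bot']
    intro v hv
    rw [hf] at hv
    have hbot : stdBot i v = 0 := by
      rcases Nat.eq_zero_or_pos i.val with h0 | h0
      · exact stdBot_of_eq_zero h0 v
      · have := congrArg (idem k n (i.val - 1) • ·) hv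
        simp only [smul_add, hcomm, hix, hil, smul_zero] at this
        rw [if_neg (by omega), if_pos (by omega), smul_zero, zero_add, smul_eq_zero] at this
        exact this.resolve_right (hlx' h0)
    rw [hbot, zero_smul, add_zero, smul_eq_zero] at hv
    exact std_ext (by simpa using hv.resolve_right hx₀) (by simpa using hbot)
  · -- A cycle of the quotient lifts to a cycle of `M`, because the range of `f` is itself exact.
    intro z h₀ hz
    obtain ⟨z, rfl⟩ := Submodule.mkQ_surjective _ z
    rw [← map_smul] at h₀ hz
    simp only [Submodule.mkQ_apply, Submodule.Quotient.mk_eq_zero] at h₀ hz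
    suffices ∃ w : M, z - lower k n • w ∈ LinearMap.range f by
      obtain ⟨w, hw⟩ := this
      refine ⟨Submodule.mkQ _ w, ?_⟩
      rw [← map_smul, Submodule.mkQ_apply, Submodule.mkQ_apply, eq_comm, Submodule.Quotient.eq]
      exact hw
    -- Subtracting an element of the range, `z` may be assumed to vanish at the first vertex.
    wlog hz₀ : idem k n 0 • z = 0 generalizing z
    · obtain ⟨w, hw⟩ := this (z - idem k n 0 • z) (by simp [smul_sub])
        (by simpa [smul_sub] using hz) (by simp [smul_sub])
      exact ⟨w, by simpa [sub_right_comm] using add_mem hw h₀⟩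
    rcases Nat.eq_zero_or_pos i.val with h0 | h0
    · refine ⟨0, ?_⟩
      have : z = 0 := by
        rw [← sum_idem_smul (k := k) (n := n) z]
        refine Finset.sum_eq_zero fun j _ => ?_
        rcases Nat.eq_zero_or_pos j with rfl | hj
        · exact hz₀
        · exact hmax _ _ (by omega)
      simp [this]
    · obtain ⟨v, hv⟩ := hz
      rw [hf] at hv
      have htop : stdTop i v = 0 := by
        have := congrArg (lower k n • ·) hv
        simp only [smul_add, hcomm, lower_smul_lower_smul, smul_zero, add_zero,
          smul_eq_zero] at this
        exact this.resolve_right (hlx' h0)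
      rw [htop, zero_smul, zero_add] at hv
      obtain ⟨w, hw⟩ := h (z - stdBot i v • x)
        (by rw [smul_sub, hz₀, hcomm, hix, if_neg h0.ne', smul_zero, sub_zero])
        (by rw [smul_sub, hcomm, hv, sub_self])
      refine ⟨w, stdOfTop i (stdBot i v), ?_⟩
      rw [hf, stdBot_stdOfTop, stdTop_stdOfTop, hw]
      simp

/-- If `(M, raise)` is exact away from the first vertex, then a nonzero linear form supported at
the largest vertex `i` of the support induces a surjection onto `∇(i)`, and exactness passes to
its kernel. -/
theorem RaiseExact.exists_costd [Module k M] [IsScalarTower k (Lam k n) M] [Nontrivial M]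
    (h : RaiseExact k n M) : ∃ (i : Fin n) (g : M →ₗ[Lam k n] Costd k i), Function.Surjective g ∧
      ∀ z, g z = 0 → idem k n 0 • z = 0 → raise k n • z = 0 → ∃ w, g w = 0 ∧ raise k n • w = z := by
  obtain ⟨i, x, hx₀, hx, hmax⟩ := exists_max_vertex k n M
  have hrx : raise k n • x = 0 := raise_smul_eq_zero_of_max hmax hx
  obtain ⟨ψ, hψ⟩ := Module.Projective.exists_dual_eq_one k hx₀
  let φ : M →ₗ[k] k := ψ ∘ₗ Algebra.lsmul k k M (idem k n i)
  have hφ : ∀ y, φ y = ψ (idem k n i • y) := fun y => rfl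
  have hφx : φ x = 1 := by rw [hφ, hx, hψ]
  have hφi : ∀ j y, φ (idem k n j • y) = if i.val = j then φ y else 0 := fun j y => by
    split_ifs with hj
    · rw [hφ, hφ, ← hj, idem_smul_idem_smul_self]
    · rw [hφ, idem_smul_idem_smul_of_ne hj, map_zero]
  have hφl : ∀ y, φ (lower k n • y) = 0 := fun y => by
    rw [hφ, idem_smul_lower_smul, hmax _ _ (Nat.lt_succ_self _), smul_zero, map_zero]
  have hφr : i.val = 0 → ∀ y, φ (raise k n • y) = 0 := fun h0 y => by
    rw [hφ, h0, idem_zero_smul_raise_smul, map_zero]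
  let g₀ : M →ₗ[k] Costd k i :=
    costdMk i ∘ₗ φ.prod (φ ∘ₗ Algebra.lsmul k k M (raise k n))
  have hg₀ : ∀ y, g₀ y = costdMk i (φ y, φ (raise k n • y)) := fun y => rfl
  let g : M →ₗ[Lam k n] Costd k i := lamLinearMap g₀
    (fun j y => by
      rw [hg₀, hg₀, idem_smul_costdMk, ← idem_succ_smul_raise_smul, hφi, hφi])
    (fun y => by
      rw [hg₀, hg₀, raise_smul_costdMk _ fun h0 => hφr h0 y, raise_smul_raise_smul, map_zero])
    (fun y => by rw [hg₀, hφl, raise_smul_lower_smul, map_zero, costd_lower_smul]; exact map_zero _)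
  have hg : ∀ y, g y = costdMk i (φ y, φ (raise k n • y)) := fun y => rfl
  have hφ_ker : ∀ y, φ y = 0 → φ (raise k n • y) = 0 → g y = 0 := fun y h₁ h₂ => by
    rw [hg, h₁, h₂]; exact map_zero _
  have hker_φ : ∀ y, g y = 0 → φ y = 0 := fun y hy => by
    have := congrArg (fun v => costdCoord i v ⟨i, Or.inl rfl⟩) hy
    simpa [hg, costdCoord_costdMk] using this
  refine ⟨i, g, fun v => ?_, ?_⟩
  · obtain ⟨⟨c, d⟩, hcd, rfl⟩ := exists_eq_costdMk v
    rcases Nat.eq_zero_or_pos i.val with h0 | h0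
    · refine ⟨c • x, ?_⟩
      rw [hg, smul_comm, hrx, smul_zero, map_zero, map_smul, hφx, ← hcd h0, smul_eq_mul, mul_one]
    · obtain ⟨y, hy⟩ := h x (by rw [← hx, idem_smul_idem_smul_of_ne h0.ne]) hrx
      -- The part of `y` at the vertex preceding `i` is still a preimage of `x`.
      have hy' : raise k n • idem k n (i.val - 1) • y = x := by
        rw [← idem_succ_smul_raise_smul, hy, Nat.sub_add_cancel h0, hx]
      refine ⟨c • x + d • idem k n (i.val - 1) • y, ?_⟩
      rw [hg, smul_add, smul_comm _ c, hrx, smul_zero, zero_add, smul_comm _ d, hy', map_add,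
        φ.map_smul, φ.map_smul, φ.map_smul, hφx, hφi, if_neg (by omega)]
      simp
  · intro z hz h₀ hrz
    obtain ⟨w, rfl⟩ := h z h₀ hrz
    have hrw := hker_φ _ hz
    -- The vector `x` is a cocycle with `φ x = 1`, so it corrects `w` to an element of the kernel.
    refine ⟨w - φ w • x, hφ_ker _ ?_ ?_, ?_⟩
    · rw [map_sub, map_smul, hφx, smul_eq_mul, mul_one, sub_self]
    · rw [smul_sub, smul_comm, hrx, smul_zero, sub_zero, hrw]
    · rw [smul_sub, smul_comm, hrx, smul_zero, sub_zero]

end Steps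

section Filtrations

variable {R : Type*} [Ring R] {ι : Type*} {D : ι → Type*} [∀ i, AddCommGroup (D i)]
  [∀ i, Module R (D i)] [∀ i, Nontrivial (D i)] {M : Type*} [AddCommGroup M] [Module R M]

variable (D) in
/-- The submodule `S` is contained in `T`, with a member of the family `D` as subquotient. -/
def IsFiltrationStep (S T : Submodule R M) : Prop :=
  S ≤ T ∧ ∃ i : ι, Nonempty ((T ⧸ S.submoduleOf T) ≃ₗ[R] D i)

theorem IsFiltrationStep.ne {S T : Submodule R M} (h : IsFiltrationStep D S T) : S ≠ T := by
  rintro rfl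
  obtain ⟨-, i, ⟨e⟩⟩ := h
  have : Subsingleton (S ⧸ S.submoduleOf S) :=
    (Submodule.unique_quotient_iff_eq_top.2 (Submodule.submoduleOf_self S)).elim
      fun _ => inferInstance
  exact not_subsingleton (D i) e.symm.toEquiv.subsingleton

/-- A filtration is obtained by successively choosing copies of members of the family in the
quotients by the submodules reached so far. -/
theorem hasFiltrationBy_of_exists_injective [IsNoetherian R M] (P : Submodule R M → Prop)
    (bot : P ⊥) (step : ∀ S, P S → S ≠ ⊤ → ∃ (i : ι) (f : D i →ₗ[R] M ⧸ S),
      Function.Injective f ∧ P ((LinearMap.range f).comap S.mkQ)) :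
    HasFiltrationBy (R := R) D M := by
  let good : Set (Submodule R M) := {S | P S ∧ ∃ (r : ℕ) (F : ℕ → Submodule R M),
    F 0 = ⊥ ∧ F r = S ∧ ∀ s < r, IsFiltrationStep D (F s) (F (s + 1))}
  have hbot : ⊥ ∈ good := ⟨bot, 0, fun _ => ⊥, rfl, rfl, by simp⟩
  obtain ⟨S, ⟨hS, r, F, hF₀, hFr, hF⟩, hmax⟩ :=
    set_has_maximal_iff_noetherian.2 ‹_› good ⟨_, hbot⟩
  suffices S = ⊤ from ⟨r, F, hF₀, hFr.trans this, hF⟩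
  by_contra hne
  obtain ⟨i, f, hf, hP⟩ := step S hS hne
  set T : Submodule R M := (LinearMap.range f).comap S.mkQ with hT
  have hST : S ≤ T := fun x hx => by
    rw [hT, Submodule.mem_comap, Submodule.mkQ_apply, (Submodule.Quotient.mk_eq_zero S).2 hx]
    exact zero_mem _
  let q : T →ₗ[R] LinearMap.range f := S.mkQ.restrict fun _ hx => hx
  have hq : Function.Surjective q := by
    rintro ⟨y, hy⟩
    obtain ⟨x, rfl⟩ := S.mkQ_surjective y
    exact ⟨⟨x, hy⟩, rfl⟩
  have hker : S.submoduleOf T = LinearMap.ker q := by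
    ext x
    rw [LinearMap.mem_ker, ← Submodule.coe_eq_zero]
    exact (Submodule.Quotient.mk_eq_zero S).symm
  have e : (T ⧸ S.submoduleOf T) ≃ₗ[R] D i :=
    Submodule.quotEquivOfEq _ _ hker ≪≫ₗ q.quotKerEquivOfSurjective hq ≪≫ₗ
      (LinearEquiv.ofInjective f hf).symm
  have hstep : IsFiltrationStep D S T := ⟨hST, i, ⟨e⟩⟩
  refine hmax T ⟨hP, r + 1, fun s => if s ≤ r then F s else T, by simpa using hF₀, by simp,
    fun s hs => ?_⟩ (lt_of_le_of_ne hST hstep.ne)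
  beta_reduce
  rcases Nat.lt_succ_iff_lt_or_eq.1 hs with hs | rfl
  · rw [if_pos hs.le, if_pos (Nat.succ_le_iff.2 hs)]
    exact hF s hs
  · rwa [if_pos le_rfl, if_neg (Nat.not_succ_le_self s), hFr]

/-- A filtration is obtained by successively choosing members of the family as quotients of the
submodules reached so far. -/
theorem hasFiltrationBy_of_exists_surjective [IsArtinian R M] (P : Submodule R M → Prop)
    (top : P ⊤) (step : ∀ S, P S → S ≠ ⊥ → ∃ (i : ι) (g : S →ₗ[R] D i),
      Function.Surjective g ∧ P ((LinearMap.ker g).map S.subtype)) :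
    HasFiltrationBy (R := R) D M := by
  let good : Set (Submodule R M) := {S | P S ∧ ∃ (r : ℕ) (F : ℕ → Submodule R M),
    F 0 = S ∧ F r = ⊤ ∧ ∀ s < r, IsFiltrationStep D (F s) (F (s + 1))}
  have htop : ⊤ ∈ good := ⟨top, 0, fun _ => ⊤, rfl, rfl, by simp⟩
  obtain ⟨S, ⟨hS, r, F, hF₀, hFr, hF⟩, hmin⟩ := IsArtinian.set_has_minimal good ⟨_, htop⟩
  suffices S = ⊥ from ⟨r, F, hF₀.trans this, hFr, hF⟩
  by_contra hne
  obtain ⟨i, g, hg, hP⟩ := step S hS hne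
  set T : Submodule R M := (LinearMap.ker g).map S.subtype with hT
  have hTS : T ≤ S := Submodule.map_subtype_le S _
  have hker : T.submoduleOf S = LinearMap.ker g :=
    Submodule.comap_map_eq_of_injective S.subtype_injective _
  have e : (S ⧸ T.submoduleOf S) ≃ₗ[R] D i :=
    Submodule.quotEquivOfEq _ _ hker ≪≫ₗ g.quotKerEquivOfSurjective hg
  have hstep : IsFiltrationStep D T S := ⟨hTS, i, ⟨e⟩⟩
  refine hmin T ⟨hP, r + 1, fun s => Nat.casesOn s T F, rfl, hFr, fun s hs => ?_⟩
    (lt_of_le_of_ne hTS hstep.ne)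
  rcases s with _ | s
  · rwa [← hF₀] at hstep
  · exact hF s (Nat.lt_of_succ_lt_succ hs)

end Filtrations

section

variable {k : Type*} [Field k] {n : ℕ} {M : Type*} [AddCommGroup M] [Module (Lam k n) M]
  [Module k M] [IsScalarTower k (Lam k n) M] [FiniteDimensional k M]

instance (i : Fin n) : Nonempty (Supp i) := ⟨⟨i, Or.inl rfl⟩⟩

instance (i : Fin n) : Nontrivial (Std k i) := (stdCoord i).toEquiv.nontrivial

instance (i : Fin n) : Nontrivial (Costd k i) := (costdCoord i).toEquiv.nontrivial

/-- A finite-dimensional module which is exact away from the first vertex for `lower` has a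
standard filtration. -/
theorem LowerExact.hasStandardFiltration (h : LowerExact k n M) :
    HasStandardFiltration k n M := by
  have : IsNoetherian (Lam k n) M := isNoetherian_of_tower k inferInstance
  refine hasFiltrationBy_of_exists_injective (fun S => LowerExact k n (M ⧸ S))
    (h.of_equiv (Submodule.quotEquivOfEqBot ⊥ rfl).symm) fun S hS hne => ?_
  have : Nontrivial (M ⧸ S) := Submodule.Quotient.nontrivial_iff.2 hne
  obtain ⟨i, f, hf, hex⟩ := hS.exists_std
  refine ⟨i, f, hf, hex.of_equiv ?_⟩
  have hmap : ((LinearMap.range f).comap S.mkQ).map S.mkQ = LinearMap.range f :=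
    Submodule.map_comap_eq_of_surjective S.mkQ_surjective _
  exact Submodule.quotEquivOfEq _ _ hmap.symm ≪≫ₗ
    Submodule.quotientQuotientEquivQuotient S _ (Submodule.le_comap_mkQ S _)

/-- A finite-dimensional module which is exact away from the first vertex for `raise` has a
costandard filtration. -/
theorem RaiseExact.hasCostandardFiltration (h : RaiseExact k n M) :
    HasCostandardFiltration k n M := by
  have : IsArtinian (Lam k n) M := isArtinian_of_tower k inferInstance
  refine hasFiltrationBy_of_exists_surjective
    (fun S => ∀ z ∈ S, idem k n 0 • z = 0 → raise k n • z = 0 → ∃ w ∈ S, raise k n • w = z)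
    (fun z _ h₀ hz => (h z h₀ hz).imp fun w hw => ⟨trivial, hw⟩) fun S hS hne => ?_
  have : Nontrivial S := Submodule.nontrivial_iff_ne_bot.2 hne
  have hS' : RaiseExact k n S := fun z h₀ hz => by
    obtain ⟨w, hw, hwz⟩ := hS z z.2 (congrArg Subtype.val h₀) (congrArg Subtype.val hz)
    exact ⟨⟨w, hw⟩, Subtype.ext hwz⟩
  obtain ⟨i, g, hg, hex⟩ := hS'.exists_costd
  refine ⟨i, g, hg, ?_⟩
  rintro _ ⟨z, hz, rfl⟩ h₀ hrz
  obtain ⟨w, hw, rfl⟩ := hex z hz (Subtype.ext h₀) (Subtype.ext hrz)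
  exact ⟨w, ⟨w, hw, rfl⟩, rfl⟩

end

/-! ### A basis of `Λ_n`, projective and injective modules -/

section NormalForm

variable {k : Type*} [Field k] {n : ℕ}

variable (k n) in
/-- The linear combinations of the idempotents of `Λ_n`. -/
def idemSpan : Submodule k (Lam k n) := Submodule.span k (Set.range fun i : Fin n => idem k n i)

theorem exists_eq_sum_of_mem_idemSpan {s : Lam k n} (hs : s ∈ idemSpan k n) :
    ∃ c : Fin n → k, ∑ i, c i • idem k n i = s :=
  (Submodule.mem_span_range_iff_exists_fun k).1 hs

theorem idem_mem_idemSpan (i : ℕ) : idem k n i ∈ idemSpan k n := by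
  rcases lt_or_ge i n with h | h
  · exact Submodule.subset_span ⟨⟨i, h⟩, rfl⟩
  · rw [idem_of_le h]; exact zero_mem _

theorem one_mem_idemSpan : (1 : Lam k n) ∈ idemSpan k n := by
  rw [← sum_idem]
  exact sum_mem fun i _ => idem_mem_idemSpan i

theorem idem_mul_mem_idemSpan (i : ℕ) {s : Lam k n} (hs : s ∈ idemSpan k n) :
    idem k n i * s ∈ idemSpan k n := by
  obtain ⟨c, rfl⟩ := exists_eq_sum_of_mem_idemSpan hs
  rw [Finset.mul_sum]
  refine sum_mem fun j _ => ?_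
  rw [mul_smul_comm, idem_mul_idem]
  split_ifs
  · exact Submodule.smul_mem _ _ (idem_mem_idemSpan i)
  · rw [smul_zero]; exact zero_mem _

theorem exists_raise_mul_eq {s : Lam k n} (hs : s ∈ idemSpan k n) :
    ∃ t ∈ idemSpan k n, raise k n * s = t * raise k n := by
  obtain ⟨c, rfl⟩ := exists_eq_sum_of_mem_idemSpan hs
  refine ⟨∑ i, c i • idem k n (i + 1), sum_mem fun i _ =>
    Submodule.smul_mem _ _ (idem_mem_idemSpan _), ?_⟩
  rw [Finset.mul_sum, Finset.sum_mul]
  exact Finset.sum_congr rfl fun i _ => by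
    rw [mul_smul_comm, smul_mul_assoc, idem_succ_mul_raise_comm]

/-- `Λ_n` is spanned by the paths `e i`, `α i`, `α' i` and `α' i α i`. -/
theorem exists_normalForm (x : Lam k n) : ∃ s₀ ∈ idemSpan k n, ∃ s₁ ∈ idemSpan k n,
    ∃ s₂ ∈ idemSpan k n, ∃ s₃ ∈ idemSpan k n,
      x = s₀ + raise k n * s₁ + lower k n * s₂ + lower k n * (raise k n * s₃) := by
  -- The elements of this form contain `1` and are stable under left multiplication.
  suffices ∀ y : Lam k n, (∃ s₀ ∈ idemSpan k n, ∃ s₁ ∈ idemSpan k n,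
      ∃ s₂ ∈ idemSpan k n, ∃ s₃ ∈ idemSpan k n,
      y = s₀ + raise k n * s₁ + lower k n * s₂ + lower k n * (raise k n * s₃)) →
      ∃ s₀ ∈ idemSpan k n, ∃ s₁ ∈ idemSpan k n, ∃ s₂ ∈ idemSpan k n, ∃ s₃ ∈ idemSpan k n,
      x * y = s₀ + raise k n * s₁ + lower k n * s₂ + lower k n * (raise k n * s₃) by
    simpa using this 1 ⟨1, one_mem_idemSpan, 0, zero_mem _, 0, zero_mem _, 0, zero_mem _, by simp⟩
  induction x using lam_induction with
  | algebraMap c =>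
    rintro _ ⟨s₀, h₀, s₁, h₁, s₂, h₂, s₃, h₃, rfl⟩
    refine ⟨c • s₀, Submodule.smul_mem _ _ h₀, c • s₁, Submodule.smul_mem _ _ h₁,
      c • s₂, Submodule.smul_mem _ _ h₂, c • s₃, Submodule.smul_mem _ _ h₃, ?_⟩
    simp only [← Algebra.smul_def, smul_add, mul_smul_comm]
  | idem i =>
    rintro _ ⟨s₀, h₀, s₁, h₁, s₂, h₂, s₃, h₃, rfl⟩
    have key : ∀ j, ∀ s ∈ idemSpan k n, ∃ t ∈ idemSpan k n,
        idem k n j * (raise k n * s) = raise k n * t := by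
      rintro (_ | j) s hs
      · exact ⟨0, zero_mem _, by rw [← mul_assoc, idem_zero_mul_raise, zero_mul, mul_zero]⟩
      · exact ⟨_, idem_mul_mem_idemSpan j hs, by
          rw [← mul_assoc, idem_succ_mul_raise_comm, mul_assoc]⟩
    obtain ⟨t₁, ht₁, e₁⟩ := key i s₁ h₁
    obtain ⟨t₃, ht₃, e₃⟩ := key (i + 1) s₃ h₃
    refine ⟨_, idem_mul_mem_idemSpan i h₀, t₁, ht₁, _, idem_mul_mem_idemSpan (i + 1) h₂,
      t₃, ht₃, ?_⟩
    have hl : ∀ y, idem k n i * (lower k n * y) = lower k n * (idem k n (i + 1) * y) := fun y => by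
      rw [← mul_assoc, idem_mul_lower_comm, mul_assoc]
    rw [mul_add, mul_add, mul_add, e₁, hl, hl, e₃]
  | raise =>
    rintro _ ⟨s₀, h₀, s₁, h₁, s₂, h₂, s₃, h₃, rfl⟩
    refine ⟨0, zero_mem _, s₀, h₀, 0, zero_mem _, 0, zero_mem _, ?_⟩
    simp [mul_add, ← mul_assoc]
  | lower =>
    rintro _ ⟨s₀, h₀, s₁, h₁, s₂, h₂, s₃, h₃, rfl⟩
    refine ⟨0, zero_mem _, 0, zero_mem _, s₀, h₀, s₁, h₁, ?_⟩
    simp [mul_add, ← mul_assoc]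
  | add x y hx hy =>
    intro z hz
    obtain ⟨s₀, h₀, s₁, h₁, s₂, h₂, s₃, h₃, hs⟩ := hx z hz
    obtain ⟨t₀, g₀, t₁, g₁, t₂, g₂, t₃, g₃, ht⟩ := hy z hz
    refine ⟨_, add_mem h₀ g₀, _, add_mem h₁ g₁, _, add_mem h₂ g₂, _, add_mem h₃ g₃, ?_⟩
    rw [add_mul, hs, ht]
    simp only [mul_add]
    abel
  | mul x y hx hy =>
    intro z hz
    rw [mul_assoc]
    exact hx _ (hy z hz)

/-- Action of the generators on the three-dimensional uniserial module with composition factors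
`L(j)`, `L(j + 1)`, `L(j)` from top to socle. -/
def loopGen (j : ℕ) : Gen n → Matrix (Fin 3) (Fin 3) k
  | .vertex i => !![if j = i.val then 1 else 0, 0, 0; 0, if j + 1 = i.val then 1 else 0, 0;
      0, 0, if j = i.val then 1 else 0]
  | .up i _ => !![0, 0, 0; if j = i then 1 else 0, 0, 0; 0, 0, 0]
  | .down i _ => !![0, 0, 0; 0, 0, 0; 0, if j = i then 1 else 0, 0]

theorem loopGen_rel (j : ℕ) (hj : j + 1 < n) ⦃x y : FreeAlgebra k (Gen n)⦄ (h : Rel k n x y) :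
    FreeAlgebra.lift k (loopGen (k := k) j) x = FreeAlgebra.lift k (loopGen (k := k) j) y := by
  have hs : ∀ c, c < n → ∑ i : Fin n, (if c = i.val then (1 : k) else 0) = 1 := fun c hc => by
    rw [Finset.sum_eq_single (⟨c, hc⟩ : Fin n)] <;> simp [Fin.ext_iff, eq_comm]
  cases h
  case one =>
    ext s t
    simp only [fe, map_sum, FreeAlgebra.lift_ι_apply, loopGen, Matrix.sum_apply, map_one]
    fin_cases s <;> fin_cases t <;> simp [hs j (by omega), hs (j + 1) hj]
  all_goals
    simp only [fe, fα, fα', map_mul, FreeAlgebra.lift_ι_apply, loopGen, map_zero, lo, hi,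
      Matrix.mul_fin_three, mul_zero, zero_mul, add_zero, zero_add]
  all_goals
    ext s t
    fin_cases s <;> fin_cases t <;> simp
  all_goals grind

/-- The representation of `Λ_n` on the three-dimensional uniserial module with composition factors
`L(j)`, `L(j + 1)`, `L(j)` from top to socle. -/
noncomputable def loopRep (j : ℕ) (hj : j + 1 < n) : Lam k n →ₐ[k] Matrix (Fin 3) (Fin 3) k :=
  RingQuot.liftAlgHom k ⟨FreeAlgebra.lift k (loopGen j), loopGen_rel j hj⟩

theorem loopRep_mkAlgHom (j : ℕ) (hj : j + 1 < n) (g : Gen n) :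
    loopRep (k := k) j hj (RingQuot.mkAlgHom k (Rel k n) (FreeAlgebra.ι k g)) = loopGen j g := by
  simp [loopRep]

theorem loopRep_raise (j : ℕ) (hj : j + 1 < n) :
    loopRep (k := k) j hj (raise k n) = !![0, 0, 0; 1, 0, 0; 0, 0, 0] := by
  rw [raise, map_sum, Finset.sum_eq_single_of_mem j (Finset.mem_range.2 (by omega))]
  · simp [up, hj, fα, loopRep_mkAlgHom, loopGen]
  · intro i _ hi
    unfold up
    split_ifs
    · rw [fα, loopRep_mkAlgHom, loopGen, if_neg hi.symm]
      ext s t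
      fin_cases s <;> fin_cases t <;> rfl
    · rw [map_zero]

theorem loopRep_lower (j : ℕ) (hj : j + 1 < n) :
    loopRep (k := k) j hj (lower k n) = !![0, 0, 0; 0, 0, 0; 0, 1, 0] := by
  rw [lower, map_sum, Finset.sum_eq_single_of_mem j (Finset.mem_range.2 (by omega))]
  · simp [down, hj, fα', loopRep_mkAlgHom, loopGen]
  · intro i _ hi
    unfold down
    split_ifs
    · rw [fα', loopRep_mkAlgHom, loopGen, if_neg hi.symm]
      ext s t
      fin_cases s <;> fin_cases t <;> rfl
    · rw [map_zero]

theorem loopRep_sum_idem (j : ℕ) (hj : j + 1 < n) (c : Fin n → k) :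
    loopRep j hj (∑ i, c i • idem k n i) =
      !![c ⟨j, by omega⟩, 0, 0; 0, c ⟨j + 1, hj⟩, 0; 0, 0, c ⟨j, by omega⟩] := by
  have h : ∀ i : Fin n, loopRep j hj (idem k n i) = loopGen j (.vertex i) := fun i => by
    rw [idem, dif_pos i.2, fe, loopRep_mkAlgHom]
  have hs : ∀ a (ha : a < n), ∑ i : Fin n, c i * (if a = i.val then (1 : k) else 0) = c ⟨a, ha⟩ :=
    fun a ha => by
      rw [Finset.sum_eq_single (⟨a, ha⟩ : Fin n) (fun i _ hi => ?_) (by simp), if_pos rfl, mul_one]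
      rw [if_neg fun hai => hi (Fin.ext hai.symm), mul_zero]
  simp only [map_sum, map_smul, h]
  ext s t
  simp only [Matrix.sum_apply, Matrix.smul_apply, loopGen, smul_eq_mul]
  fin_cases s <;> fin_cases t <;> simp only [Matrix.of_apply] <;>
    first | exact hs _ _ | simp

theorem sum_idem_eq_of_succ_eq_zero {c : Fin n → k}
    (h : ∀ (j : ℕ) (hj : j + 1 < n), c ⟨j + 1, hj⟩ = 0) :
    ∃ a : k, ∑ i, c i • idem k n i = a • idem k n 0 := by
  obtain _ | n := n
  · exact ⟨0, by simp⟩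
  · refine ⟨c 0, Finset.sum_eq_single 0 (fun i _ hi => ?_) (by simp)⟩
    obtain ⟨_ | i, hin⟩ := i
    · exact absurd rfl hi
    · rw [h i hin, zero_smul]

theorem raise_mul_sum_idem_eq_zero {c : Fin n → k}
    (h : ∀ (j : ℕ) (hj : j + 1 < n), c ⟨j, by omega⟩ = 0) :
    raise k n * ∑ i, c i • idem k n i = 0 := by
  rw [Finset.mul_sum]
  refine Finset.sum_eq_zero fun i _ => ?_
  rw [mul_smul_comm, raise_mul_idem]
  by_cases hi : i.val + 1 < n
  · rw [h i hi, zero_smul]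
  · rw [up, dif_neg hi, smul_zero]

/-- The left regular module is exact away from the first vertex with respect to `lower`. -/
theorem exists_eq_of_lower_mul_eq_zero {x : Lam k n} (hx : lower k n * x = 0) :
    ∃ (y : Lam k n) (a : k), x = lower k n * y + a • idem k n 0 := by
  obtain ⟨s₀, h₀, s₁, h₁, s₂, -, s₃, -, rfl⟩ := exists_normalForm x
  obtain ⟨c, rfl⟩ := exists_eq_sum_of_mem_idemSpan h₀
  obtain ⟨d, rfl⟩ := exists_eq_sum_of_mem_idemSpan h₁
  have key : ∀ (j : ℕ) (hj : j + 1 < n), d ⟨j, by omega⟩ = 0 ∧ c ⟨j + 1, hj⟩ = 0 := by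
    intro j hj
    have := congrArg (loopRep j hj) hx
    simp only [mul_add, map_add, map_mul, loopRep_raise, loopRep_lower, loopRep_sum_idem,
      ← mul_assoc, lower_mul_lower] at this
    have h₁ := congrFun (congrFun this 2) 0
    have h₂ := congrFun (congrFun this 2) 1
    simp at h₁ h₂
    exact ⟨h₁, h₂⟩
  obtain ⟨a, ha⟩ := sum_idem_eq_of_succ_eq_zero fun j hj => (key j hj).2
  refine ⟨s₂ + raise k n * s₃, a, ?_⟩
  rw [ha, raise_mul_sum_idem_eq_zero fun j hj => (key j hj).1, mul_add]
  abel

/-- The right regular module is exact away from the first vertex with respect to `raise`. -/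
theorem exists_eq_of_mul_raise_eq_zero {x : Lam k n} (hx : x * raise k n = 0) :
    ∃ (y : Lam k n) (a : k), x = y * raise k n + a • idem k n 0 := by
  obtain ⟨s₀, h₀, s₁, h₁, s₂, h₂, s₃, h₃, rfl⟩ := exists_normalForm x
  obtain ⟨c, rfl⟩ := exists_eq_sum_of_mem_idemSpan h₀
  obtain ⟨d, rfl⟩ := exists_eq_sum_of_mem_idemSpan h₂
  obtain ⟨t₁, -, e₁⟩ := exists_raise_mul_eq h₁
  obtain ⟨t₃, -, e₃⟩ := exists_raise_mul_eq h₃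
  have hx' : (∑ i, c i • idem k n i) * raise k n +
      lower k n * (∑ i, d i • idem k n i) * raise k n = 0 := by
    simpa [e₁, e₃, add_mul, mul_assoc] using hx
  have key : ∀ (j : ℕ) (hj : j + 1 < n), c ⟨j + 1, hj⟩ = 0 ∧ d ⟨j + 1, hj⟩ = 0 := by
    intro j hj
    have := congrArg (loopRep j hj) hx'
    simp only [map_add, map_mul, loopRep_raise, loopRep_lower, loopRep_sum_idem] at this
    have h₁ := congrFun (congrFun this 1) 0
    have h₂ := congrFun (congrFun this 2) 0
    simp at h₁ h₂
    exact ⟨h₁, h₂⟩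
  obtain ⟨a, ha⟩ := sum_idem_eq_of_succ_eq_zero fun j hj => (key j hj).1
  obtain ⟨b, hb⟩ := sum_idem_eq_of_succ_eq_zero fun j hj => (key j hj).2
  refine ⟨t₁ + lower k n * t₃, a, ?_⟩
  rw [ha, hb, e₁, e₃, mul_smul_comm, lower_mul_idem_zero, smul_zero, add_mul, mul_assoc]
  abel

end NormalForm

section ProjectiveInjective

variable {k : Type*} [Field k] {n : ℕ}

theorem lowerExact_lam : LowerExact k n (Lam k n) := by
  intro x h₀ hx
  simp only [smul_eq_mul] at h₀ hx ⊢
  obtain ⟨y, a, rfl⟩ := exists_eq_of_lower_mul_eq_zero hx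
  -- Removing the component at the first vertex absorbs the multiple of the idempotent.
  refine ⟨y - idem k n 1 * y, ?_⟩
  rw [mul_add, mul_smul_comm, idem_mul_self, ← mul_assoc, idem_mul_lower_comm, mul_assoc] at h₀
  rw [mul_sub, eq_neg_of_add_eq_zero_left h₀, sub_neg_eq_add]

theorem LowerExact.finsupp {M : Type*} [AddCommGroup M] [Module (Lam k n) M]
    (h : LowerExact k n M) (ι : Type*) : LowerExact k n (ι →₀ M) := by
  classical
  intro z h₀ hz
  choose w hw using fun i => h (z i) (DFunLike.congr_fun h₀ i) (DFunLike.congr_fun hz i)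
  refine ⟨Finsupp.onFinset z.support (fun i => if z i = 0 then 0 else w i) fun i hi => ?_, ?_⟩
  · rw [Finsupp.mem_support_iff]
    exact fun hzi => hi (if_pos hzi)
  · ext i
    rw [Finsupp.smul_apply, Finsupp.onFinset_apply]
    split_ifs with hzi
    · rw [smul_zero, hzi]
    · exact hw i

/-- An injective module is exact away from the first vertex with respect to `raise`. -/
theorem raiseExact_of_injective {I : Type*} [AddCommGroup I] [Module (Lam k n) I]
    (hI : Module.Baer (Lam k n) I) : RaiseExact k n I := by
  intro z h₀ hz
  -- By exactness of the right regular module, `x * raise ↦ x • z` is well defined on the left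
  -- ideal generated by `raise`; the image of `1` under an extension is a preimage of `z`.
  let μ : Lam k n →ₗ[Lam k n] Lam k n := LinearMap.toSpanSingleton _ _ (raise k n)
  let ν : Lam k n →ₗ[Lam k n] I := LinearMap.toSpanSingleton _ _ z
  have hker : LinearMap.ker μ ≤ LinearMap.ker ν := by
    intro x hx
    rw [LinearMap.mem_ker, LinearMap.toSpanSingleton_apply, smul_eq_mul] at hx
    obtain ⟨y, a, rfl⟩ := exists_eq_of_mul_raise_eq_zero hx
    rw [LinearMap.mem_ker, LinearMap.toSpanSingleton_apply, add_smul, mul_smul, hz, smul_zero,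
      zero_add, Algebra.smul_def, mul_smul, h₀, smul_zero]
  let θ : LinearMap.range μ →ₗ[Lam k n] I :=
    (LinearMap.ker μ).liftQ ν hker ∘ₗ μ.quotKerEquivRange.symm.toLinearMap
  have hθ : θ ⟨raise k n, 1, by simp [μ]⟩ = z := by
    have : μ.quotKerEquivRange.symm ⟨raise k n, 1, by simp [μ]⟩ = (LinearMap.ker μ).mkQ 1 := by
      rw [LinearEquiv.symm_apply_eq]
      exact Subtype.ext (by simp [μ])
    simp only [θ, LinearMap.comp_apply, LinearEquiv.coe_coe, this]
    simp [ν]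
  obtain ⟨g, hg⟩ := hI (LinearMap.range μ) θ
  refine ⟨g 1, ?_⟩
  rw [← map_smul, smul_eq_mul, mul_one, hg _ ⟨1, by simp [μ]⟩, hθ]

end ProjectiveInjective

/-! ### Extensions from homology classes -/

section Classes

variable (k : Type*) [Field k] (n : ℕ) (M : Type*) [AddCommGroup M] [Module (Lam k n) M]

/-- The homology of the complex `(M, lower)` at the vertex with value `i` is nonzero. -/
def HasLowerClass (i : ℕ) : Prop :=
  ∃ z : M, idem k n i • z = z ∧ lower k n • z = 0 ∧ ∀ w : M, lower k n • w ≠ z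

/-- The cohomology of the complex `(M, raise)` at the vertex with value `i` is nonzero. -/
def HasRaiseClass (i : ℕ) : Prop :=
  ∃ z : M, idem k n i • z = z ∧ raise k n • z = 0 ∧ ∀ w : M, raise k n • w ≠ z

variable {k n M}

theorem exists_hasLowerClass (h : ¬ LowerExact k n M) : ∃ i, HasLowerClass k n M (i + 1) := by
  contrapose! h
  intro z h₀ hz
  have hc : ∀ i, ∃ w : M, lower k n • w = idem k n i • z := by
    rintro (_ | i)
    · exact ⟨0, by rw [h₀, smul_zero]⟩
    · by_contra! hw
      refine h i ⟨idem k n (i + 1) • z, idem_smul_idem_smul_self _ _, ?_, hw⟩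
      rw [← idem_smul_lower_smul, hz, smul_zero]
  choose w hw using hc
  refine ⟨∑ i ∈ Finset.range n, w i, ?_⟩
  rw [Finset.smul_sum, Finset.sum_congr rfl fun i _ => hw i, sum_idem_smul]

theorem exists_hasRaiseClass (h : ¬ RaiseExact k n M) : ∃ i, HasRaiseClass k n M (i + 1) := by
  contrapose! h
  intro z h₀ hz
  have hc : ∀ i, ∃ w : M, raise k n • w = idem k n i • z := by
    rintro (_ | i)
    · exact ⟨0, by rw [h₀, smul_zero]⟩
    · by_contra! hw
      refine h i ⟨idem k n (i + 1) • z, idem_smul_idem_smul_self _ _, ?_, hw⟩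
      rw [← idem_succ_smul_raise_smul, hz, smul_zero]
  choose w hw using hc
  refine ⟨∑ i ∈ Finset.range n, w i, ?_⟩
  rw [Finset.smul_sum, Finset.sum_congr rfl fun i _ => hw i, sum_idem_smul]

end Classes

section FirstSimple

variable {k : Type*} [Field k] {n : ℕ} {M : Type*} [AddCommGroup M] [Module (Lam k n) M]

theorem idem_smul_stdOfTop_of_val_eq_zero {i : Fin n} (hi : i.val = 0) (j : ℕ) (c : k) :
    idem k n j • stdOfTop i c = stdOfTop i (if j = 0 then c else 0) := by
  refine std_ext ?_ (by rw [stdBot_of_eq_zero hi, stdBot_of_eq_zero hi])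
  rw [stdTop_idem_smul, stdTop_stdOfTop, stdTop_stdOfTop, hi]
  exact if_congr eq_comm rfl rfl

theorem lower_smul_std_of_val_eq_zero {i : Fin n} (hi : i.val = 0) (v : Std k i) :
    lower k n • v = 0 :=
  std_ext (by simp) (by rw [stdBot_of_eq_zero hi, stdBot_of_eq_zero hi])

/-- A vector at the first vertex killed by `raise` is the image of the basis vector under a map
from the simple module `Δ(1) = L(1)`. -/
theorem exists_hom_std_zero {i : Fin n} (hi : i.val = 0) {y : M} (hy : idem k n 0 • y = y)
    (hry : raise k n • y = 0) :
    ∃ g : Std k i →ₗ[Lam k n] M, ∀ v, g v = algebraMap k (Lam k n) (stdTop i v) • y := by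
  let _ : Module k M := Module.compHom M (algebraMap k (Lam k n))
  have : IsScalarTower k (Lam k n) M := ⟨fun c a x => by rw [Algebra.smul_def, mul_smul]; rfl⟩
  have hly : lower k n • y = 0 := by rw [← hy, lower_smul_idem_zero_smul]
  refine ⟨lamLinearMap ((stdTop i).smulRight y) (fun j v => ?_) (fun v => ?_) (fun v => ?_),
    fun v => rfl⟩
  · simp only [LinearMap.smulRight_apply]
    rw [stdTop_idem_smul, smul_comm, hi]
    split_ifs with hj
    · rw [← hj, hy]
    · rw [← hy, idem_smul_idem_smul_of_ne (Ne.symm hj), zero_smul, smul_zero]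
  · simp only [LinearMap.smulRight_apply]
    rw [std_raise_smul, map_zero, zero_smul, smul_comm, hry, smul_zero]
  · simp only [LinearMap.smulRight_apply]
    rw [stdTop_lower_smul, zero_smul, smul_comm, hly, smul_zero]

/-- A homology class of `(M, lower)` at the first vertex represented by a vector killed by `raise`
splits off a direct summand `L(1)`. -/
theorem exists_retract_std_zero {i : Fin n} (hi : i.val = 0) {y : M} (hy : idem k n 0 • y = y)
    (hry : raise k n • y = 0) (hly : ∀ w : M, lower k n • w ≠ y) :
    ∃ (g : Std k i →ₗ[Lam k n] M) (r : M →ₗ[Lam k n] Std k i), r ∘ₗ g = LinearMap.id := by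
  obtain ⟨g, hg⟩ := exists_hom_std_zero hi hy hry
  let _ : Module k M := Module.compHom M (algebraMap k (Lam k n))
  have : IsScalarTower k (Lam k n) M := ⟨fun c a x => by rw [Algebra.smul_def, mul_smul]; rfl⟩
  obtain ⟨ψ, hψy, hψ⟩ := Submodule.exists_le_ker_of_notMem
    (p := LinearMap.range (Algebra.lsmul k k M (lower k n))) (v := y)
    fun ⟨w, hw⟩ => hly w hw
  have hψl : ∀ w, ψ (lower k n • w) = 0 := fun w => hψ ⟨w, rfl⟩
  let φ : M →ₗ[k] k := (ψ y)⁻¹ • ψ ∘ₗ Algebra.lsmul k k M (idem k n 0)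
  have hφ : ∀ w, φ w = (ψ y)⁻¹ * ψ (idem k n 0 • w) := fun w => rfl
  refine ⟨g, lamLinearMap (stdOfTop i ∘ₗ φ) (fun j w => ?_) (fun w => ?_) (fun w => ?_), ?_⟩
  · rw [LinearMap.comp_apply, LinearMap.comp_apply, idem_smul_stdOfTop_of_val_eq_zero hi, hφ, hφ]
    split_ifs with hj
    · rw [hj, idem_smul_idem_smul_self]
    · rw [idem_smul_idem_smul_of_ne (Ne.symm hj), map_zero, mul_zero]
  · rw [LinearMap.comp_apply, hφ, idem_zero_smul_raise_smul, map_zero, mul_zero, map_zero,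
      std_raise_smul]
  · rw [LinearMap.comp_apply, hφ, idem_smul_lower_smul, hψl, mul_zero, map_zero,
      lower_smul_std_of_val_eq_zero hi]
  · ext v
    refine std_ext ?_ (by rw [stdBot_of_eq_zero hi, stdBot_of_eq_zero hi])
    have : φ (g v) = stdTop i v := by
      rw [hg]
      change φ (stdTop i v • y) = _
      rw [map_smul, hφ, hy, inv_mul_cancel₀ hψy, smul_eq_mul, mul_one]
    rw [LinearMap.comp_apply, lamLinearMap_apply, LinearMap.comp_apply, this, stdTop_stdOfTop]
    rfl

end FirstSimple

section DimensionShift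

open CategoryTheory Abelian

variable {k : Type u} [Field k] {n : ℕ} {S : ShortComplex (ModuleCat.{u} (Lam k n))}

/-- The connecting map of `raise`-cohomology. The last property says that the class produced in
`S.X₃` is not the image of a cocycle of `S.X₂`. -/
theorem HasRaiseClass.shift (hS : S.ShortExact) (h₂ : RaiseExact k n S.X₂) {i : ℕ}
    (h : HasRaiseClass k n S.X₁ (i + 1)) :
    ∃ c : S.X₃, idem k n i • c = c ∧ raise k n • c = 0 ∧ (∀ w : S.X₃, raise k n • w ≠ c) ∧
      ∀ w : S.X₂, raise k n • w = 0 → S.g.hom w ≠ c := by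
  have hex := (ShortComplex.ShortExact.moduleCat_exact_iff_function_exact S).1 hS.exact
  have hinj := hS.moduleCat_injective_f
  have hsurj := hS.moduleCat_surjective_g
  obtain ⟨z, hz, hrz, hne⟩ := h
  obtain ⟨w₀, hw₀⟩ := h₂ (S.f.hom z)
    (by rw [← map_smul, ← hz, idem_smul_idem_smul_of_ne (Nat.succ_ne_zero i).symm, map_zero])
    (by rw [← map_smul, hrz, map_zero])
  have hw : raise k n • idem k n i • w₀ = S.f.hom z := by
    rw [← idem_succ_smul_raise_smul, hw₀, ← map_smul, hz]
  set w := idem k n i • w₀ with hwdef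
  -- A vector of `S.X₂` with the same image under `raise` cannot differ from `w` by one of `S.X₁`.
  have key : ∀ w' : S.X₂, raise k n • w' = 0 → S.g.hom w' ≠ S.g.hom w := by
    intro w' hw' he
    obtain ⟨y, hy⟩ := (hex (w - w')).1 (by rw [map_sub, he, sub_self])
    exact hne y (hinj (by
      change S.f.hom (raise k n • y) = S.f.hom z
      rw [map_smul]
      change raise k n • S.f y = _
      rw [hy, smul_sub, hw', sub_zero, hw]))
  refine ⟨S.g.hom w, by rw [← map_smul, hwdef, idem_smul_idem_smul_self], ?_, ?_, key⟩
  · rw [← map_smul, hw]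
    exact (hex _).2 ⟨z, rfl⟩
  · intro c hc
    obtain ⟨w', rfl⟩ := hsurj c
    refine key (raise k n • w') (raise_smul_raise_smul _) ?_
    rw [map_smul]
    exact hc

/-- The connecting map of `lower`-homology. The vector produced in `S.X₁` is killed by `raise`,
because it is of the form `lower • w` in `S.X₂`. -/
theorem HasLowerClass.shift (hS : S.ShortExact) (h₂ : LowerExact k n S.X₂) {i : ℕ}
    (h : HasLowerClass k n S.X₃ (i + 1)) :
    ∃ y : S.X₁, idem k n i • y = y ∧ lower k n • y = 0 ∧ (∀ w : S.X₁, lower k n • w ≠ y) ∧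
      raise k n • y = 0 := by
  have hex := (ShortComplex.ShortExact.moduleCat_exact_iff_function_exact S).1 hS.exact
  have hinj : Function.Injective S.f.hom := hS.moduleCat_injective_f
  have hsurj := hS.moduleCat_surjective_g
  obtain ⟨z, hz, hlz, hne⟩ := h
  obtain ⟨w₀, hw₀⟩ := hsurj z
  have hw : S.g.hom (idem k n (i + 1) • w₀) = z := by
    rw [map_smul]
    exact (congrArg _ hw₀).trans hz
  set w := idem k n (i + 1) • w₀ with hwdef
  obtain ⟨y, hy⟩ := (hex (lower k n • w)).1 (by
    change S.g.hom (lower k n • w) = 0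
    rw [map_smul, hw, hlz])
  replace hy : S.f.hom y = lower k n • w := hy
  refine ⟨y, hinj ?_, hinj ?_, fun y' hy' => ?_, hinj ?_⟩
  · rw [map_smul, hy, idem_smul_lower_smul, hwdef, idem_smul_idem_smul_self]
  · rw [map_smul, hy, lower_smul_lower_smul, map_zero]
  · have hidem : idem k n 0 • (w - S.f.hom (idem k n (i + 1) • y')) = 0 := by
      rw [smul_sub, ← map_smul, hwdef, idem_smul_idem_smul_of_ne (Nat.succ_ne_zero i).symm,
        idem_smul_idem_smul_of_ne (Nat.succ_ne_zero i).symm, map_zero, sub_zero]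
    have hyi : lower k n • idem k n (i + 1) • y' = y := hinj (by
      rw [← idem_smul_lower_smul, hy', map_smul, hy, idem_smul_lower_smul, hwdef,
        idem_smul_idem_smul_self])
    obtain ⟨v, hv⟩ := h₂ _ hidem (by rw [smul_sub, ← map_smul, hyi, hy, sub_self])
    refine hne (S.g.hom v) ?_
    rw [← map_smul, hv, map_sub, hw, sub_eq_self]
    exact (hex _).2 ⟨_, rfl⟩
  · rw [map_smul, hy, raise_smul_lower_smul, map_zero]

/-- The inclusion of a module into an injective module, with its cokernel. -/
noncomputable def injectiveShortComplex (N : ModuleCat.{u} (Lam k n)) :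
    ShortComplex (ModuleCat.{u} (Lam k n)) :=
  ShortComplex.mk (Injective.ι N) (Limits.cokernel.π (Injective.ι N)) (by simp)

theorem shortExact_injectiveShortComplex (N : ModuleCat.{u} (Lam k n)) :
    (injectiveShortComplex N).ShortExact where
  exact := ShortComplex.exact_cokernel _
  mono_f := inferInstanceAs (Mono (Injective.ι N))
  epi_g := inferInstanceAs (Epi (Limits.cokernel.π (Injective.ι N)))

instance (N : ModuleCat.{u} (Lam k n)) : Injective (injectiveShortComplex N).X₂ :=
  inferInstanceAs (Injective (Injective.under N))

theorem raiseExact_injectiveShortComplex (N : ModuleCat.{u} (Lam k n)) :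
    RaiseExact k n (injectiveShortComplex N).X₂ :=
  raiseExact_of_injective <| Module.Baer.iff_injective.2 <|
    have : Injective (ModuleCat.of (Lam k n) (Injective.under N : ModuleCat.{u} (Lam k n))) :=
      inferInstanceAs (Injective (Injective.under N))
    Module.injective_module_of_injective_object (Lam k n)
      (Injective.under N : ModuleCat.{u} (Lam k n))

theorem lowerExact_projectiveShortComplex (M : ModuleCat.{u} (Lam k n)) :
    LowerExact k n M.projectiveShortComplex.X₂ :=
  (lowerExact_lam.of_equiv (Shrink.linearEquiv.{u} (Lam k n) (Lam k n)).symm).finsupp M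

/-- A `raise`-cohomology class of `N` at the vertex `u` gives an extension of degree `u - 1` of
`L(1)` by `N`. -/
theorem HasRaiseClass.not_subsingleton_ext {i : Fin n} (hi : i.val = 0) {j : ℕ}
    {N : ModuleCat.{u} (Lam k n)} (h : HasRaiseClass k n N (j + 1)) :
    ¬ Subsingleton (Ext (ModuleCat.of (Lam k n) (Std k i)) N (j + 1)) := by
  have hS := shortExact_injectiveShortComplex N
  have hX := raiseExact_injectiveShortComplex N
  induction j generalizing N with
  | zero =>
    intro hsub
    obtain ⟨c, hc, hrc, -, hne⟩ := HasRaiseClass.shift hS hX h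
    obtain ⟨g, hg⟩ := exists_hom_std_zero hi hc hrc
    -- The map `L(1) ⟶ S.X₃` given by `c` would lift to the injective module.
    obtain ⟨x, hx⟩ := Ext.covariant_sequence_exact₃ _ hS (Ext.mk₀ (ModuleCat.ofHom g)) (zero_add 1)
      (hsub.elim _ _)
    obtain ⟨f, rfl⟩ := (Ext.mk₀_bijective _ _).2 x
    rw [Ext.mk₀_comp_mk₀] at hx
    have hfg := (Ext.mk₀_bijective _ _).1 hx
    refine hne (f.hom (stdOfTop i 1)) ?_ ?_
    · rw [← map_smul]
      exact (congrArg f.hom (std_raise_smul _)).trans (map_zero _)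
    · refine (congrArg (fun f => f.hom (stdOfTop i 1)) hfg).trans ((hg _).trans ?_)
      rw [stdTop_stdOfTop, map_one, one_smul]
  | succ j ih =>
    intro hsub
    obtain ⟨c, hc, hrc, hne, -⟩ := HasRaiseClass.shift hS hX h
    refine ih (N := (injectiveShortComplex N).X₃) ⟨c, hc, hrc, hne⟩
      (shortExact_injectiveShortComplex _) (raiseExact_injectiveShortComplex _)
      (subsingleton_of_forall_eq 0 fun x => ?_)
    obtain ⟨y, rfl⟩ := Ext.covariant_sequence_exact₃ _ hS x rfl (hsub.elim _ _)
    rw [Ext.eq_zero_of_injective y, Ext.zero_comp]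

theorem subsingleton_ext_of_projective_X₂ (hS : S.ShortExact) [Projective S.X₂]
    (N : ModuleCat.{u} (Lam k n)) {m : ℕ} (h : Subsingleton (Ext S.X₃ N (m + 1 + 1))) :
    Subsingleton (Ext S.X₁ N (m + 1)) := by
  refine subsingleton_of_forall_eq 0 fun x => ?_
  obtain ⟨y, rfl⟩ := Ext.contravariant_sequence_exact₁ hS N x (add_comm 1 (m + 1)) (h.elim _ _)
  rw [Ext.eq_zero_of_projective y, Ext.comp_zero]

/-- The case `v = 2`: the kernel of a surjection from a projective module has `L(1)` as a direct
summand. -/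
theorem HasLowerClass.not_subsingleton_ext_of_shortExact (hS : S.ShortExact) [Projective S.X₂]
    (h₂ : LowerExact k n S.X₂) {j : ℕ} {N : ModuleCat.{u} (Lam k n)}
    (h : HasLowerClass k n S.X₃ 1) (hN : HasRaiseClass k n N (j + 1)) :
    ¬ Subsingleton (Ext S.X₃ N (j + 1 + 1)) := by
  intro hsub
  obtain ⟨y, hy, -, hly, hry⟩ := HasLowerClass.shift hS h₂ h
  have := subsingleton_ext_of_projective_X₂ hS N hsub
  have hn : 0 < n := Nat.pos_of_ne_zero fun h0 => hly 0 <| by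
    rw [← hy, idem_of_le h0.le, zero_smul, smul_zero]
  obtain ⟨g, r, hgr⟩ := exists_retract_std_zero (i := ⟨0, hn⟩) rfl hy hry hly
  refine hN.not_subsingleton_ext (i := ⟨0, hn⟩) rfl (subsingleton_of_forall_eq 0 fun x => ?_)
  have hcomp : ModuleCat.ofHom g ≫ ModuleCat.ofHom r = 𝟙 _ := by
    rw [← ModuleCat.ofHom_comp, hgr, ModuleCat.ofHom_id]
  have hx : (Ext.mk₀ (ModuleCat.ofHom r)).comp x (zero_add (j + 1)) = 0 := this.elim _ _
  rw [← Ext.mk₀_id_comp x, ← hcomp, ← Ext.mk₀_comp_mk₀_assoc, hx, Ext.comp_zero]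

/-- A `lower`-homology class of `M` at the vertex `v` and a `raise`-cohomology class of `N` at the
vertex `u` give an extension of degree `u + v - 2` of `M` by `N`. -/
theorem HasLowerClass.not_subsingleton_ext {i j : ℕ} {M N : ModuleCat.{u} (Lam k n)}
    (hM : HasLowerClass k n M (i + 1)) (hN : HasRaiseClass k n N (j + 1)) :
    ¬ Subsingleton (Ext M N (i + j + 1 + 1)) := by
  have hS := M.shortExact_projectiveShortComplex
  have hX := lowerExact_projectiveShortComplex M
  have : Projective M.projectiveShortComplex.X₂ := inferInstance
  induction i generalizing M with
  | zero =>
    rw [Nat.zero_add]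
    exact HasLowerClass.not_subsingleton_ext_of_shortExact hS hX hM hN
  | succ i ih =>
    intro hsub
    obtain ⟨y, hy, hly, hne, -⟩ := HasLowerClass.shift hS hX hM
    refine ih ⟨y, hy, hly, hne⟩ (ModuleCat.shortExact_projectiveShortComplex _)
      (lowerExact_projectiveShortComplex _) inferInstance
      (subsingleton_ext_of_projective_X₂ hS N ?_)
    rwa [show i + j + 1 + 1 = i + 1 + j + 1 by omega]

end DimensionShift

end DualExtension

theorem mainTheorem8 (k : Type u) [Field k] [IsAlgClosed k] (n : ℕ) (hn : 1 < n)
    (M : Type u) [AddCommGroup M] [Module k M] [Module (DualExtension.Lam k n) M]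
    [IsScalarTower k (DualExtension.Lam k n) M] [FiniteDimensional k M]
    (hM : CategoryTheory.Indecomposable (ModuleCat.of (DualExtension.Lam k n) M))
    (hstd : ¬ DualExtension.HasStandardFiltration k n M)
    (hcostd : ¬ DualExtension.HasCostandardFiltration k n M) :
    ¬ DualExtension.IsSelfOrthogonal (DualExtension.Lam k n) M := by
  intro h
  obtain ⟨i, hi⟩ := DualExtension.exists_hasLowerClass fun h => hstd h.hasStandardFiltration
  obtain ⟨j, hj⟩ := DualExtension.exists_hasRaiseClass fun h => hcostd h.hasCostandardFiltration
  exact DualExtension.HasLowerClass.not_subsingleton_ext (M := ModuleCat.of _ M)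
    (N := ModuleCat.of _ M) hi hj (h _ (Nat.succ_pos _))
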